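/- **Setting.** Let $T_0,\tau_0,\rho_\infty>0$, let $\mathbb T$ be the torus of length $|\mathbb T|>0$, and let $m\ge 0$, $N_H\ge 1$, $N_x\ge 1$ be integers. Cut $\mathbb T$ into cells $K_j=[x_{j-1/2},x_{j+1/2}]$, $j=1,\dots,N_x$ (with $x_{N_x+1/2}$ identified with $x_{1/2}$), of sizes $h_j>0$ with $\max_j h_j\le C_{qu}\min_j h_j$. Let $U_h^m$ be the space of functions that are polynomials of degree at most $m$ on each cell, $\langle\cdot,\cdot\rangle$ the $L^2(\mathbb T)$ inner product, $u^\pm$ the right and left limits of $u$ at an interface, and $[u]=u^+-u^-$. For a sign $s\in\{+,-\}$ put $$\Lambda^s(u,w)=\sum_j u^s_{j-1/2}[w]_{j-1/2}+\sum_j\int_{K_j}u\,\partial_xw\,dx .$$ *Kinetic equation.* Fix $s\in\{+,-\}$ and put $a_h=-\sqrt{T_0}\,\Lambda^{s}$, $a_h^*=\sqrt{T_0}\,\Lambda^{-s}$ (alternating fluxes). *Poisson equation.* Let $V_h=\{v\in U_h^m:\langle v,1\rangle=0\}$ and choose one of the following. - Local discontinuous Galerkin: $W_h=U_h^m$, $b_h=-\Lambda^{\sigma}$,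 $b_h^*=\Lambda^{-\sigma}$ with a sign $\sigma\in\{+,-\}$. - Raviart–Thomas: $W_h=U_h^{m+1}\cap C^0(\mathbb T)$, $b_h(\Phi,w)=-\sum_j\int_{K_j}\Phi\,\partial_xw\,dx$, $b_h^*(E,v)=-\sum_j\int_{K_j}\partial_xE\,v\,dx$. *Semi-discrete scheme.* On an interval $I\subseteq[0,\infty)$ containing $0$ (in particular $I=[0,\infty)$), a solution consists of $D_{h,k}(t)\in U_h^m$ for $0\le k\le N_H$, differentiable in $t$, with $D_{h,N_H+1}=0$, and of $\Phi_h(t)\in V_h$, $E_h(t)\in W_h$, such that for all $t\in I$, all $u\in U_h^m$, $w\in W_h$, $v\in V_h$: $$\langle\partial_tD_{h,0},u\rangle-a_h^*(D_{h,1},u)=0,$$ $$\langle\partial_tD_{h,1},u\rangle+a_h(D_{h,0},u)-\sqrt2\,a_h^*(D_{h,2},u)+\tfrac{\rho_\infty}{T_0}a_h(\Phi_h,u)-\tfrac1{\sqrt{T_0}}\langle E_h(D_{h,0}-\rho_\infty),u\rangle=-\tfrac1{\tau_0}\langle D_{h,1},u\rangle,$$ $$\langle\partial_tD_{h,k},u\rangle+\sqrt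 k\,a_h(D_{h,k-1},u)-\sqrt{k+1}\,a_h^*(D_{h,k+1},u)-\sqrt{\tfrac k{T_0}}\langle E_hD_{h,k-1},u\rangle=-\tfrac k{\tau_0}\langle D_{h,k},u\rangle\quad(2\le k\le N_H),$$ $$\langle E_h,w\rangle=-b_h(\Phi_h,w),\qquad -b_h^*(E_h,v)=\langle D_{h,0}-\rho_\infty,v\rangle,\qquad \langle D_{h,0}-\rho_\infty,1\rangle=0 .$$ *Energy.* Let $\mathcal M(v)=(2\pi T_0)^{-1/2}e^{-v^2/(2T_0)}$ and $e_k(v)=H_k(v/\sqrt{T_0})\mathcal M(v)$, where $H_k=\mathrm{He}_k/\sqrt{k!}$ are the normalised probabilists' Hermite polynomials. Put $f_h=\sum_{k=0}^{N_H}D_{h,k}\,e_k$, $f_\infty=\rho_\infty\mathcal M$ and $$\mathcal E_h(t)=\frac12\int_{\mathbb T}\int_{\mathbb R}|f_h(t,x,v)-f_\infty(v)|^2f_\infty(v)^{-1}\,dv\,dx+\frac1{2T_0}\|E_h(t)\|_{L^2(\mathbb T)}^2 .$$ **Theorem.** For all $T_0>0$, $|\mathbb T|>0$, $m\in\mathbb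 N$ and $C_{qu}>0$ there is a constant $\kappa>0$, depending only on these four data (not on the mesh, $N_x$, $N_H$, $\tau_0$, $\rho_\infty$, the choice of fluxes or the choice of the Poisson discretisation), such that for every solution on $I$: if $$\mathcal E_h(0)\le\frac{\kappa^2}{\rho_\infty}\min(\tau_0^2,\tau_0^{-2}),$$ then $$\mathcal E_h(t)\le 3\,\mathcal E_h(0)\,e^{-\kappa\min(\tau_0,\tau_0^{-1})\,t}\qquad\text{for all }t\in I .$$ For the normalised background $\rho_\infty=1$ the smallness condition reads $\mathcal E_h(0)\le\kappa^2\min(\tau_0^2,\tau_0^{-2})$. -/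

import Mathlib

noncomputable section

namespace VPFP

open Polynomial

/-! ### Velocity variable: Maxwellian and Hermite functions -/

/-- The Maxwellian `M(v) = (2π T₀)^{-1/2} exp(-v² / (2 T₀))`. -/
def maxwellian (T₀ v : ℝ) : ℝ :=
  (Real.sqrt (2 * Real.pi * T₀))⁻¹ * Real.exp (-v ^ 2 / (2 * T₀))

/-- The normalised Hermite polynomials `H_k = He_k / √(k!)`, where `He_k` are the monic
(probabilists') Hermite polynomials; `ξ H_k = √k H_{k-1} + √(k+1) H_{k+1}`, `H_0 = 1`. -/
def hermiteN (k : ℕ) (ξ : ℝ) : ℝ :=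
  aeval ξ (Polynomial.hermite k) / Real.sqrt (k.factorial : ℝ)

/-- The Hermite functions `e_k(v) = H_k(v / √T₀) M(v)`. -/
def hermiteFun (T₀ : ℝ) (k : ℕ) (v : ℝ) : ℝ :=
  hermiteN k (v / Real.sqrt T₀) * maxwellian T₀ v

/-! ### Periodic meshes and piecewise polynomials -/

/-- A mesh of the torus of length `L` with `N` cells `[node j, node (j + 1)]`;
the last node is identified with the first one. -/
structure Mesh (N : ℕ) (L : ℝ) where
  node : Fin (N + 1) → ℝ
  strictMono : StrictMono node
  length_eq : node (Fin.last N) - node 0 = L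

/-- Functions on the torus that are polynomial on each cell: one polynomial per cell
(the class in `L²` of such a function is the same as this family). -/
abbrev PW (N : ℕ) : Type := Fin N → ℝ[X]

namespace Mesh

variable {N : ℕ} {L : ℝ}

/-- Left end of the cell `j`. -/
def left (M : Mesh N L) (j : Fin N) : ℝ := M.node j.castSucc

/-- Right end of the cell `j`. -/
def right (M : Mesh N L) (j : Fin N) : ℝ := M.node j.succ

/-- Size of the cell `j`. -/
def size (M : Mesh N L) (j : Fin N) : ℝ := M.right j - M.left j

/-- `max_j h_j ≤ C min_j h_j`. -/
def QuasiUniform (M : Mesh N L) (C : ℝ) : Prop := ∀ i j, M.size i ≤ C * M.size j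

/-- The `L²` inner product on the torus. -/
def ip (M : Mesh N L) (u w : PW N) : ℝ :=
  ∑ j, ∫ x in M.left j..M.right j, (u j).eval x * (w j).eval x

end Mesh

/-- Piecewise constant extension of a real number. -/
def const (N : ℕ) (c : ℝ) : PW N := fun _ => C c

/-- Broken derivative. -/
def deriv {N : ℕ} (u : PW N) : PW N := fun j => derivative (u j)

/-- The space `U_h^m` of piecewise polynomials of degree at most `m`. -/
def U (N m : ℕ) : Set (PW N) := {u | ∀ j, (u j).natDegree ≤ m}

/-- The side from which a one-sided limit is taken. -/
inductive Side
  | minus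
  | plus

/-- The opposite side. -/
def Side.opp : Side → Side
  | .minus => .plus
  | .plus => .minus

section Forms

variable {N : ℕ} [NeZero N] {L : ℝ}

/-- One-sided limit of `u` at the left interface of the cell `j`. The cell preceding `j` is
`j - 1` in the cyclic arithmetic of `Fin N`, in accordance with periodicity. -/
def trace (M : Mesh N L) : Side → PW N → Fin N → ℝ
  | .minus, u, j => (u (j - 1)).eval (M.right (j - 1))
  | .plus, u, j => (u j).eval (M.left j)

/-- Jump `u⁺ - u⁻` at the left interface of the cell `j`. -/
def jump (M : Mesh N L) (u : PW N) (j : Fin N) : ℝ :=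
  trace M .plus u j - trace M .minus u j

/-- `∑_j û_{j-1/2} [w]_{j-1/2} + ∑_j ∫_{K_j} u ∂_x w`, with the numerical flux `û = u^s`. -/
def fluxForm (M : Mesh N L) (s : Side) (u w : PW N) : ℝ :=
  (∑ j, trace M s u j * jump M w j) + M.ip u (deriv w)

/-- The form `a_h`, with flux `ĝ_a(D) = D^s`. -/
def aForm (M : Mesh N L) (T₀ : ℝ) (s : Side) (D u : PW N) : ℝ :=
  -(Real.sqrt T₀ * fluxForm M s D u)

/-- The form `a_h^*`, with the alternating flux `ĝ_a^*(D)`, taken from the other side. -/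
def aStar (M : Mesh N L) (T₀ : ℝ) (s : Side) (D u : PW N) : ℝ :=
  Real.sqrt T₀ * fluxForm M s.opp D u

/-- Discretisations of the Poisson equation: local discontinuous Galerkin with flux
`ĝ_b(Φ) = Φ^s` and `ĝ_b^*(E)` taken from the other side, or Raviart–Thomas. -/
inductive Poisson
  | ldg (s : Side)
  | rt

/-- `V_h`: the functions of `U_h^m` with zero mean. -/
def V (M : Mesh N L) (m : ℕ) : Set (PW N) := {v | v ∈ U N m ∧ M.ip v (const N 1) = 0}

/-- `W_h`: `U_h^m` for the LDG method, and `U_h^{m+1} ∩ C⁰(𝕋)` for the Raviart–Thomas method. -/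
def W (M : Mesh N L) (m : ℕ) : Poisson → Set (PW N)
  | .ldg _ => U N m
  | .rt => {w | w ∈ U N (m + 1) ∧ ∀ j, trace M .minus w j = trace M .plus w j}

/-- The form `b_h` on `V_h × W_h`. -/
def bForm (M : Mesh N L) : Poisson → PW N → PW N → ℝ
  | .ldg s, Φ, w => -fluxForm M s Φ w
  | .rt, Φ, w => -M.ip Φ (deriv w)

/-- The form `b_h^*` on `W_h × V_h`. -/
def bStar (M : Mesh N L) : Poisson → PW N → PW N → ℝ
  | .ldg s, E, v => fluxForm M s.opp E v
  | .rt, E, v => -M.ip (deriv E) v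

/-- `(Φ, E) ∈ V_h × W_h` solves the discrete Poisson problem with density `D0` and
neutralising background `ρ`, including the quasi-neutrality condition. -/
structure SolvesPoisson (M : Mesh N L) (m : ℕ) (P : Poisson) (ρ : ℝ) (D0 Φ E : PW N) :
    Prop where
  memV : Φ ∈ V M m
  memW : E ∈ W M m P
  field : ∀ w ∈ W M m P, M.ip E w = -bForm M P Φ w
  gauss : ∀ v ∈ V M m, -bStar M P E v = M.ip (D0 - const N ρ) v
  neutral : M.ip (D0 - const N ρ) (const N 1) = 0

/-- `u'` is the time derivative at `t`, relative to the time set `I`, of the curve `u` of piecewise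
polynomials (in each cell, coefficient by coefficient). -/
def HasTimeDeriv (I : Set ℝ) (u : ℝ → PW N) (u' : PW N) (t : ℝ) : Prop :=
  ∀ j i, HasDerivWithinAt (fun r => (u r j).coeff i) ((u' j).coeff i) I t

/-- `(D, Φ, E)` solves the semi-discrete scheme on the time set `I`, with the Hermite modes
`D k`, `0 ≤ k ≤ NH`, the closure `D (NH + 1) = 0` and the background density `ρ`.
`s` is the flux of the kinetic equation and `P` the discretisation of the Poisson equation. -/
structure IsSolution (M : Mesh N L) (m NH : ℕ) (s : Side) (P : Poisson) (T₀ τ₀ ρ : ℝ)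
    (I : Set ℝ) (D : ℕ → ℝ → PW N) (Φ E : ℝ → PW N) : Prop where
  mem : ∀ t ∈ I, ∀ k ≤ NH, D k t ∈ U N m
  closure : ∀ t ∈ I, D (NH + 1) t = 0
  poisson : ∀ t ∈ I, SolvesPoisson M m P ρ (D 0 t) (Φ t) (E t)
  mode_zero : ∀ t ∈ I, ∃ D' ∈ U N m, HasTimeDeriv I (D 0) D' t ∧
    ∀ u ∈ U N m, M.ip D' u - aStar M T₀ s (D 1 t) u = 0
  mode_one : ∀ t ∈ I, ∃ D' ∈ U N m, HasTimeDeriv I (D 1) D' t ∧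
    ∀ u ∈ U N m,
      M.ip D' u + aForm M T₀ s (D 0 t) u - Real.sqrt 2 * aStar M T₀ s (D 2 t) u
        + ρ / T₀ * aForm M T₀ s (Φ t) u
        - Real.sqrt (1 / T₀) * M.ip (E t * (D 0 t - const N ρ)) u
      = -(1 / τ₀) * M.ip (D 1 t) u
  mode_ge_two : ∀ t ∈ I, ∀ k, 2 ≤ k → k ≤ NH → ∃ D' ∈ U N m, HasTimeDeriv I (D k) D' t ∧
    ∀ u ∈ U N m,
      M.ip D' u + Real.sqrt k * aForm M T₀ s (D (k - 1) t) u
        - Real.sqrt (k + 1) * aStar M T₀ s (D (k + 1) t) u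
        - Real.sqrt (k / T₀) * M.ip (E t * D (k - 1) t) u
      = -(k / τ₀) * M.ip (D k t) u

/-- The value `f_h(t, x, v) = ∑_{k ≤ NH} D_{h,k}(t, x) e_k(v)` for `x` in the cell `j`. -/
def fh (T₀ : ℝ) (NH : ℕ) (D : ℕ → ℝ → PW N) (t : ℝ) (j : Fin N) (x v : ℝ) : ℝ :=
  ∑ k ∈ Finset.range (NH + 1), (D k t j).eval x * hermiteFun T₀ k v

/-- The equilibrium `f_∞(v) = ρ M(v)`. -/
def fInf (T₀ ρ v : ℝ) : ℝ := ρ * maxwellian T₀ v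

/-- The energy `½ ‖f_h(t) - f_∞‖²_{L²(f_∞⁻¹)} + (1 / (2 T₀)) ‖E_h(t)‖²_{L²(𝕋)}`. -/
def energy (M : Mesh N L) (T₀ ρ : ℝ) (NH : ℕ) (D : ℕ → ℝ → PW N) (E : ℝ → PW N) (t : ℝ) : ℝ :=
  1 / 2 * (∑ j, ∫ x in M.left j..M.right j, ∫ v : ℝ,
      (fh T₀ NH D t j x v - fInf T₀ ρ v) ^ 2 * (fInf T₀ ρ v)⁻¹)
    + 1 / (2 * T₀) * M.ip (E t) (E t)

end Forms

end VPFP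

end

noncomputable section

namespace VPFP

open Polynomial

/-! ### Polynomials on a cell -/

/-! This is a discrete hypocoercivity argument. By Parseval in the Hermite basis, `ρ` times the
energy is `Y = ½ ∑ ‖x_k‖² + ρ/(2T₀) ‖E‖²`, where `x_k` are the modes of the perturbation. In its
time derivative the transport terms telescope over `k`, because `a_h` and `a_h^*` are adjoint, and
the linear field term cancels against the derivative of the potential energy. What remains is the
collisional damping `-τ₀⁻¹ ∑ k ‖x_k‖²` and a quadratic force term (`IsSolution.energy_balance`). The
damping does not see the density `x_0`.

To recover it, let `w` be the mean-free discrete primitive of `x_0`, that is `a_h^*(w, v) = ⟨x_0,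
v⟩`, and add `α ⟨D_1, w⟩` to `Y`. Its derivative contains `-‖x_0‖² - ρ/T₀ ‖E‖²`, besides terms that
the damping absorbs for small `α` (`IsSolution.correction_balance`, `dissipation_absorbs`). With `α`
proportional to `min(τ₀, τ₀⁻¹)` the corrected functional `F` stays within one percent of `Y` and
satisfies `F' ≤ -α Y` as long as `Y` is small. A barrier argument, `exponential_decay`, shows that
smallness persists.

Uniformity in the mesh rests on `exists_local_stability`: a discrete derivative controls the broken
derivative and one jump per cell. It yields a Poincaré inequality in the maximum norm
(`exists_flux_sup_bound`), hence bounds for `w` and for `E` in the LDG case, and, with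
quasi-uniformity, a bound for the discrete derivative taken with the opposite flux
(`exists_flux_opp_bound`). The Raviart–Thomas field is continuous, so it is bounded directly by
testing with its derivative. The maximum-norm bound `|E| ≤ K ‖x_0‖` makes the force term quadratic
with no inverse power of the mesh size. -/

/-- The `L²` inner product of two polynomials on `[a, b]`. -/
def cellIp (a b : ℝ) (p q : ℝ[X]) : ℝ := ∫ x in a..b, p.eval x * q.eval x

theorem intervalIntegrable_eval (a b : ℝ) (p : ℝ[X]) :
    IntervalIntegrable (fun x => p.eval x) MeasureTheory.volume a b :=
  p.continuous.intervalIntegrable a b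

theorem intervalIntegrable_eval_mul (a b : ℝ) (p q : ℝ[X]) :
    IntervalIntegrable (fun x => p.eval x * q.eval x) MeasureTheory.volume a b :=
  (p.continuous.mul q.continuous).intervalIntegrable a b

theorem cellIp_comm (a b : ℝ) (p q : ℝ[X]) : cellIp a b p q = cellIp a b q p := by
  simp only [cellIp, mul_comm]

theorem cellIp_add_left (a b : ℝ) (p₁ p₂ q : ℝ[X]) :
    cellIp a b (p₁ + p₂) q = cellIp a b p₁ q + cellIp a b p₂ q := by
  simp only [cellIp, eval_add, add_mul]
  exact intervalIntegral.integral_add (intervalIntegrable_eval_mul a b p₁ q)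
    (intervalIntegrable_eval_mul a b p₂ q)

theorem cellIp_smul_left (a b c : ℝ) (p q : ℝ[X]) :
    cellIp a b (c • p) q = c * cellIp a b p q := by
  simp only [cellIp, eval_smul, smul_eq_mul, mul_assoc]
  exact intervalIntegral.integral_const_mul _ _

theorem cellIp_zero_right (a b : ℝ) (q : ℝ[X]) : cellIp a b q 0 = 0 := by
  simp [cellIp]

/-- The bilinear form `cellIp`. -/
def cellForm (a b : ℝ) : LinearMap.BilinForm ℝ ℝ[X] :=
  LinearMap.mk₂ ℝ (cellIp a b) (cellIp_add_left a b) (cellIp_smul_left a b)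
    (fun p q₁ q₂ => by
      rw [cellIp_comm, cellIp_add_left, cellIp_comm a b q₁, cellIp_comm a b q₂])
    (fun c p q => by rw [cellIp_comm, cellIp_smul_left, cellIp_comm a b q]; rfl)

theorem cellForm_apply (a b : ℝ) (p q : ℝ[X]) : cellForm a b p q = cellIp a b p q := rfl

theorem cellIp_self_nonneg {a b : ℝ} (hab : a ≤ b) (p : ℝ[X]) : 0 ≤ cellIp a b p p :=
  intervalIntegral.integral_nonneg hab fun _ _ => mul_self_nonneg _

theorem cellIp_self_pos {a b : ℝ} (hab : a < b) {p : ℝ[X]} (hp : p ≠ 0) :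
    0 < cellIp a b p p := by
  obtain ⟨x, hx, hpx⟩ : ∃ x ∈ Set.Icc a b, p.eval x ≠ 0 := by
    by_contra! h
    exact hp (p.eq_zero_of_infinite_isRoot ((Set.Icc_infinite hab).mono fun x hx => h x hx))
  exact intervalIntegral.integral_pos hab (p.continuous.mul p.continuous).continuousOn
    (fun _ _ => mul_self_nonneg _) ⟨x, hx, mul_self_pos.2 hpx⟩

/-- Cauchy–Schwarz inequality on a cell. -/
theorem cellIp_sq_le {a b : ℝ} (hab : a ≤ b) (p q : ℝ[X]) :
    cellIp a b p q ^ 2 ≤ cellIp a b p p * cellIp a b q q := by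
  have h := LinearMap.BilinForm.apply_mul_apply_le_of_forall_zero_le (cellForm a b)
    (fun p => cellIp_self_nonneg hab p) p q
  simp only [cellForm_apply] at h
  rwa [cellIp_comm a b q p, ← sq] at h

theorem eval_eq_sum_fin {m : ℕ} {p : ℝ[X]} (hp : p.natDegree ≤ m) (x : ℝ) :
    p.eval x = ∑ i : Fin (m + 1), p.coeff i * x ^ (i : ℕ) := by
  rw [p.eval_eq_sum_range' (Nat.lt_succ_of_le hp), Finset.sum_range]

/-- On the unit interval the values of a polynomial are controlled by its `L²` norm. -/
theorem exists_sq_eval_le_unit (m : ℕ) :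
    ∃ C : ℝ, 0 < C ∧ ∀ p : ℝ[X], p.natDegree ≤ m → ∀ x ∈ Set.Icc (0 : ℝ) 1,
      p.eval x ^ 2 ≤ C * cellIp 0 1 p p := by
  set ev : (Fin (m + 1) → ℝ) → ℝ → ℝ := fun c x => ∑ i, c i * x ^ (i : ℕ) with hev
  set F : (Fin (m + 1) → ℝ) → ℝ := fun c => ∫ x in (0 : ℝ)..1, ev c x * ev c x with hF
  have hcont : Continuous F := by
    apply intervalIntegral.continuous_parametric_intervalIntegral_of_continuous'
    simp only [hev]
    fun_prop
  have hpoly : ∀ c : Fin (m + 1) → ℝ, ∃ p : ℝ[X], (∀ x, p.eval x = ev c x) ∧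
      ∀ i : Fin (m + 1), p.coeff i = c i := by
    intro c
    refine ⟨∑ i : Fin (m + 1), C (c i) * X ^ (i : ℕ), fun x => ?_, fun i => ?_⟩
    · simp [hev, eval_finsetSum]
    · simp only [finsetSum_coeff, coeff_C_mul, coeff_X_pow]
      rw [Finset.sum_eq_single i]
      · simp
      · intro j _ hj
        simp [Fin.val_inj, Ne.symm hj]
      · simp
  -- Equivalence of norms on coefficient space: the `L²` form has a positive minimum on the unit
  -- sphere and is homogeneous of degree two.
  obtain ⟨c₀, hc₀, hmin⟩ := (isCompact_sphere (0 : Fin (m + 1) → ℝ) 1).exists_isMinOn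
    (NormedSpace.sphere_nonempty.2 zero_le_one) hcont.continuousOn
  have hδ : 0 < F c₀ := by
    obtain ⟨p, hp, hpc⟩ := hpoly c₀
    have hp0 : p ≠ 0 := by
      rintro rfl
      have : c₀ = 0 := funext fun i => by simpa using (hpc i).symm
      rw [this] at hc₀
      simp at hc₀
    have := cellIp_self_pos one_pos hp0
    simpa only [cellIp, hp] using this
  have hlow : ∀ c, F c₀ * ‖c‖ ^ 2 ≤ F c := by
    intro c
    rcases eq_or_ne c 0 with rfl | hc
    · simp [hF, hev]
    have hn : 0 < ‖c‖ := norm_pos_iff.2 hc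
    have h1 : F c₀ ≤ F (‖c‖⁻¹ • c) := hmin (by
      simp [norm_smul, inv_mul_cancel₀ hn.ne'])
    have h2 : F (‖c‖⁻¹ • c) = (‖c‖⁻¹) ^ 2 * F c := by
      simp only [hF]
      rw [← intervalIntegral.integral_const_mul]
      congr 1
      ext x
      have : ev (‖c‖⁻¹ • c) x = ‖c‖⁻¹ * ev c x := by
        simp [hev, Finset.mul_sum, mul_assoc]
      rw [this]; ring
    rw [h2] at h1
    calc F c₀ * ‖c‖ ^ 2 ≤ (‖c‖⁻¹) ^ 2 * F c * ‖c‖ ^ 2 := by gcongr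
      _ = F c := by field_simp
  refine ⟨(m + 1) ^ 2 / F c₀, by positivity, fun p hp x hx => ?_⟩
  set c : Fin (m + 1) → ℝ := fun i => p.coeff i with hc
  have hpe : ∀ x, p.eval x = ev c x := fun x => eval_eq_sum_fin hp x
  have hFc : cellIp 0 1 p p = F c := by simp only [cellIp, hpe, hF]
  have habs : |p.eval x| ≤ (m + 1) * ‖c‖ := by
    rw [hpe]
    calc |ev c x| ≤ ∑ i, |c i * x ^ (i : ℕ)| := Finset.abs_sum_le_sum_abs _ _
      _ ≤ ∑ _i : Fin (m + 1), ‖c‖ := by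
        refine Finset.sum_le_sum fun i _ => ?_
        rw [abs_mul, abs_of_nonneg (pow_nonneg hx.1 _)]
        calc |c i| * x ^ (i : ℕ) ≤ ‖c‖ * 1 := by
              gcongr
              · exact pow_nonneg hx.1 _
              · exact norm_le_pi_norm c i
              · exact pow_le_one₀ hx.1 hx.2
          _ = ‖c‖ := mul_one _
      _ = (m + 1) * ‖c‖ := by simp
  rw [hFc, div_mul_eq_mul_div, le_div_iff₀ hδ, ← sq_abs]
  calc |p.eval x| ^ 2 * F c₀ ≤ ((m + 1) * ‖c‖) ^ 2 * F c₀ := by gcongr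
    _ = (m + 1) ^ 2 * (F c₀ * ‖c‖ ^ 2) := by ring
    _ ≤ (m + 1) ^ 2 * F c := by gcongr; exact hlow c

/-- Inverse inequality: on a cell of size `b - a` the values of a polynomial of degree at most
`m` are controlled by its `L²` norm. -/
theorem exists_sq_eval_le (m : ℕ) :
    ∃ C : ℝ, 1 ≤ C ∧ ∀ p : ℝ[X], p.natDegree ≤ m → ∀ a b : ℝ, a < b → ∀ x ∈ Set.Icc a b,
      (b - a) * p.eval x ^ 2 ≤ C * cellIp a b p p := by
  obtain ⟨K, hK, h⟩ := exists_sq_eval_le_unit m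
  refine ⟨max 1 K, le_max_left _ _, fun p hp a b hab x hx => ?_⟩
  have hba : 0 < b - a := sub_pos.2 hab
  set q : ℝ[X] := p.comp (C a + C (b - a) * X) with hq
  have hqe : ∀ y, q.eval y = p.eval (a + (b - a) * y) := fun y => by simp [hq]
  have hqd : q.natDegree ≤ m := by
    refine natDegree_comp_le.trans ?_
    have : (C a + C (b - a) * X : ℝ[X]).natDegree ≤ 1 := by compute_degree
    calc p.natDegree * _ ≤ m * 1 := Nat.mul_le_mul hp this
      _ = m := mul_one m
  have hint : (b - a) * cellIp 0 1 q q = cellIp a b p p := by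
    simp only [cellIp, hqe]
    have := intervalIntegral.mul_integral_comp_add_mul (f := fun y => p.eval y * p.eval y)
      (a := 0) (b := 1) (b - a) a
    simpa using this
  have := h q hqd ((x - a) / (b - a))
    ⟨div_nonneg (sub_nonneg.2 hx.1) hba.le, (div_le_one hba).2 (by linarith [hx.2])⟩
  rw [hqe, mul_div_cancel₀ _ hba.ne', add_sub_cancel] at this
  calc (b - a) * p.eval x ^ 2 ≤ (b - a) * (K * cellIp 0 1 q q) := by gcongr
    _ = K * cellIp a b p p := by rw [← hint]; ring
    _ ≤ max 1 K * cellIp a b p p :=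
      mul_le_mul_of_nonneg_right (le_max_right _ _) (cellIp_self_nonneg hab.le p)

theorem cellIp_one_one (a b : ℝ) : cellIp a b 1 1 = b - a := by
  simp [cellIp]

/-- A polynomial of degree at most `m` is controlled in `L²` by its product with the square root
of a weight `ω` that vanishes linearly at one end of the cell. -/
theorem cellIp_self_le_weighted {a b : ℝ} (hab : a < b) {K : ℝ} {ω q : ℝ[X]}
    (hω : ∀ x ∈ Set.Icc a b, ω.eval x ∈ Set.Icc (0 : ℝ) 1) (n : ℕ)
    (hint : ∫ x in a..b, (1 - ω.eval x) ^ n = (b - a) / (n + 1)) (hn : 2 * K ≤ n + 1)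
    (hq : ∀ x ∈ Set.Icc a b, (b - a) * q.eval x ^ 2 ≤ K * cellIp a b q q) :
    cellIp a b q q ≤ 2 * n * cellIp a b (ω * q) q := by
  have hba : 0 < b - a := sub_pos.2 hab
  set Q := cellIp a b q q with hQ
  have hQ0 : 0 ≤ Q := cellIp_self_nonneg hab.le q
  have hle : Q ≤ ∫ x in a..b, (n * ((ω * q).eval x * q.eval x)
      + K * Q / (b - a) * (1 - ω.eval x) ^ n) := by
    refine intervalIntegral.integral_mono_on hab.le (intervalIntegrable_eval_mul a b q q) ?_ ?_
    · exact Continuous.intervalIntegrable (by fun_prop) _ _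
    · intro x hx
      have h1 := hω x hx
      -- Bernoulli's inequality. The weight `(1 - ω)^n` concentrates where `ω` vanishes and has
      -- integral `(b - a)/(n + 1)`, so by the inverse inequality its contribution is at most half
      -- of `Q`.
      have h2 : 1 ≤ n * ω.eval x + (1 - ω.eval x) ^ n := by
        have := one_add_mul_le_pow (a := -ω.eval x) (by linarith [h1.2]) n
        rw [← sub_eq_add_neg] at this
        linarith
      have h3 : q.eval x ^ 2 ≤ K * Q / (b - a) := by
        rw [le_div_iff₀ hba, mul_comm]; exact hq x hx
      have h4 : 0 ≤ (1 - ω.eval x) ^ n := pow_nonneg (by linarith [h1.2]) n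
      calc q.eval x * q.eval x = q.eval x ^ 2 * 1 := by ring
        _ ≤ q.eval x ^ 2 * (n * ω.eval x + (1 - ω.eval x) ^ n) := by gcongr
        _ = n * ((ω * q).eval x * q.eval x) + q.eval x ^ 2 * (1 - ω.eval x) ^ n := by
          rw [eval_mul]; ring
        _ ≤ _ := by gcongr
  rw [intervalIntegral.integral_add ((intervalIntegrable_eval_mul a b (ω * q) q).const_mul _)
    (Continuous.intervalIntegrable (by fun_prop) _ _), intervalIntegral.integral_const_mul,
    intervalIntegral.integral_const_mul, hint] at hle
  have h5 : K * Q / (b - a) * ((b - a) / (n + 1)) = K / (n + 1) * Q := by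
    field_simp
  have h6 : K / (n + 1 : ℝ) ≤ 1 / 2 := by
    rw [div_le_div_iff₀ (by positivity) two_pos]; linarith
  have h7 : K / (n + 1 : ℝ) * Q ≤ 1 / 2 * Q := mul_le_mul_of_nonneg_right h6 hQ0
  rw [h5] at hle
  change Q ≤ n * cellIp a b (ω * q) q + _ at hle
  linarith

/-- Local stability of the discrete derivative on a cell. The number `J` stands for the jump at
the end `e` of the cell. -/
theorem exists_local_stability (m : ℕ) :
    ∃ C : ℝ, 1 ≤ C ∧ ∀ a b : ℝ, a < b → ∀ e : ℝ, e = a ∨ e = b → ∀ p g : ℝ[X],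
      p.natDegree ≤ m → ∀ J : ℝ,
      (∀ v : ℝ[X], v.natDegree ≤ m →
        v.eval e * J + cellIp a b v (derivative p) = -cellIp a b g v) →
      cellIp a b (derivative p) (derivative p) ≤ C * cellIp a b g g ∧
        J ^ 2 ≤ C * ((b - a) * cellIp a b g g) := by
  obtain ⟨K, hK, hinv⟩ := exists_sq_eval_le m
  obtain ⟨n, hn⟩ := exists_nat_ge (2 * K)
  have hn' : 2 * K ≤ (n : ℝ) + 1 := by linarith
  refine ⟨2 + 8 * n ^ 2, by nlinarith [sq_nonneg (n : ℝ)], ?_⟩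
  intro a b hab e he p g hp J hv
  have hba : 0 < b - a := sub_pos.2 hab
  set q := derivative p with hq
  have hqm : q.natDegree ≤ m - 1 := (natDegree_derivative_le p).trans (Nat.sub_le_sub_right hp 1)
  -- For `m = 0` the truncated `m - 1` is `0`, so the degree count would allow `ω * q` degree one;
  -- here `q` vanishes instead.
  have hq0 : m = 0 → q = 0 := by
    rintro rfl
    rw [hq, derivative_of_natDegree_zero (Nat.le_zero.1 hp)]
  obtain ⟨ω, hωd, hωe, hω, hint⟩ : ∃ ω : ℝ[X], ω.natDegree ≤ 1 ∧ ω.eval e = 0 ∧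
      (∀ x ∈ Set.Icc a b, ω.eval x ∈ Set.Icc (0 : ℝ) 1) ∧
      ∫ x in a..b, (1 - ω.eval x) ^ n = (b - a) / (n + 1) := by
    rcases he with rfl | rfl
    · refine ⟨C (b - e)⁻¹ * (X - C e), ?_, by simp, fun x hx => ?_, ?_⟩
      · compute_degree
      · simp only [eval_mul, eval_C, eval_sub, eval_X]
        rw [inv_mul_eq_div]
        exact ⟨div_nonneg (by linarith [hx.1]) hba.le, (div_le_one hba).2 (by linarith [hx.2])⟩
      · have h1 : ∀ x, (1 - (C (b - e)⁻¹ * (X - C e)).eval x) ^ n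
            = ((b - e)⁻¹) ^ n * (b - x) ^ n := fun x => by
          rw [← mul_pow]
          simp only [eval_mul, eval_C, eval_sub, eval_X]
          congr 1
          field_simp
          ring
        simp only [h1]
        rw [intervalIntegral.integral_const_mul,
          intervalIntegral.integral_comp_sub_left (fun y => y ^ n) b, integral_pow]
        simp only [sub_self, ne_eq, Nat.add_eq_zero_iff, one_ne_zero, and_false,
          not_false_eq_true, zero_pow, sub_zero]
        rw [inv_pow, pow_succ]
        field_simp
    · refine ⟨C (e - a)⁻¹ * (C e - X), ?_, by simp, fun x hx => ?_, ?_⟩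
      · compute_degree
      · simp only [eval_mul, eval_C, eval_sub, eval_X]
        rw [inv_mul_eq_div]
        exact ⟨div_nonneg (by linarith [hx.2]) hba.le, (div_le_one hba).2 (by linarith [hx.1])⟩
      · have h1 : ∀ x, (1 - (C (e - a)⁻¹ * (C e - X)).eval x) ^ n
            = ((e - a)⁻¹) ^ n * (x - a) ^ n := fun x => by
          rw [← mul_pow]
          simp only [eval_mul, eval_C, eval_sub, eval_X]
          congr 1
          field_simp
          ring
        simp only [h1]
        rw [intervalIntegral.integral_const_mul,
          intervalIntegral.integral_comp_sub_right (fun y => y ^ n) a, integral_pow]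
        simp only [sub_self, ne_eq, Nat.add_eq_zero_iff, one_ne_zero, and_false,
          not_false_eq_true, zero_pow, sub_zero]
        rw [inv_pow, pow_succ]
        field_simp
  have hωq : (ω * q).natDegree ≤ m := by
    rcases Nat.eq_zero_or_pos m with h0 | h0
    · simp [hq0 h0]
    · exact natDegree_mul_le.trans (by omega)
  have hcoer := cellIp_self_le_weighted hab hω n hint hn'
    (fun x hx => hinv q (hqm.trans (Nat.sub_le m 1)) a b hab x hx)
  -- The weight vanishes at `e`, so this test function removes the jump and isolates the derivative.
  -- The test function `1` then yields the jump.
  have htest := hv (ω * q) hωq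
  rw [eval_mul, hωe, zero_mul, zero_mul, zero_add] at htest
  set Q := cellIp a b q q with hQ
  set G := cellIp a b g g with hG
  have hQ0 : 0 ≤ Q := cellIp_self_nonneg hab.le q
  have hG0 : 0 ≤ G := cellIp_self_nonneg hab.le g
  have hωQ : cellIp a b (ω * q) (ω * q) ≤ Q := by
    refine intervalIntegral.integral_mono_on hab.le (intervalIntegrable_eval_mul a b _ _)
      (intervalIntegrable_eval_mul a b _ _) fun x hx => ?_
    have h1 := hω x hx
    have h2 : ω.eval x ^ 2 ≤ 1 := pow_le_one₀ h1.1 h1.2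
    calc (ω * q).eval x * (ω * q).eval x = ω.eval x ^ 2 * (q.eval x * q.eval x) := by
          rw [eval_mul]; ring
      _ ≤ 1 * (q.eval x * q.eval x) := by
          gcongr
          exact mul_self_nonneg _
      _ = _ := one_mul _
  have hcs : cellIp a b g (ω * q) ^ 2 ≤ G * Q :=
    (cellIp_sq_le hab.le g (ω * q)).trans (mul_le_mul_of_nonneg_left hωQ hG0)
  have hQG : Q ≤ 4 * n ^ 2 * G := by
    have h1 : Q ^ 2 ≤ (4 * n ^ 2 * G) * Q := by
      calc Q ^ 2 ≤ (2 * n * cellIp a b (ω * q) q) ^ 2 := by gcongr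
        _ = 4 * n ^ 2 * cellIp a b g (ω * q) ^ 2 := by rw [htest]; ring
        _ ≤ 4 * n ^ 2 * (G * Q) := by gcongr
        _ = _ := by ring
    rcases hQ0.eq_or_lt with h0 | h0
    · rw [← h0]; positivity
    · rw [sq] at h1
      exact le_of_mul_le_mul_right h1 h0
  refine ⟨hQG.trans (mul_le_mul_of_nonneg_right (by nlinarith [sq_nonneg (n : ℝ)]) hG0), ?_⟩
  have hone := hv 1 (by simp)
  rw [eval_one, one_mul] at hone
  have h1 : cellIp a b g 1 ^ 2 ≤ G * (b - a) := by
    simpa only [cellIp_one_one] using cellIp_sq_le hab.le g 1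
  have h2 : cellIp a b 1 q ^ 2 ≤ (b - a) * Q := by
    simpa only [cellIp_one_one] using cellIp_sq_le hab.le 1 q
  have hJ : J = -(cellIp a b g 1 + cellIp a b 1 q) := by linarith
  calc J ^ 2 = (cellIp a b g 1 + cellIp a b 1 q) ^ 2 := by rw [hJ]; ring
    _ ≤ 2 * (cellIp a b g 1 ^ 2 + cellIp a b 1 q ^ 2) := add_sq_le
    _ ≤ 2 * (G * (b - a) + (b - a) * (4 * n ^ 2 * G)) := by
        gcongr
        exact h2.trans (by gcongr)
    _ = (2 + 8 * n ^ 2) * ((b - a) * G) := by ring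

/-! ### The `L²` structure on piecewise polynomials -/

namespace Mesh

variable {N : ℕ} {L : ℝ} (M : Mesh N L)

theorem left_lt_right (j : Fin N) : M.left j < M.right j :=
  M.strictMono Fin.castSucc_lt_succ

theorem size_pos (j : Fin N) : 0 < M.size j := sub_pos.2 (M.left_lt_right j)

theorem sum_size : ∑ j, M.size j = L := by
  have h : ∀ j : Fin N, M.size j = M.node j.succ - M.node j.castSucc := fun _ => rfl
  simp only [h]
  rw [Finset.sum_sub_distrib]
  have h0 := M.length_eq
  have h1 := Fin.sum_univ_succ M.node
  have h2 := Fin.sum_univ_castSucc M.node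
  linarith

theorem ip_eq_sum (u w : PW N) :
    M.ip u w = ∑ j, cellIp (M.left j) (M.right j) (u j) (w j) := rfl

/-- The bilinear form `M.ip`. -/
def ipForm : LinearMap.BilinForm ℝ (PW N) :=
  ∑ j, (cellForm (M.left j) (M.right j)).compl₁₂ (LinearMap.proj j) (LinearMap.proj j)

theorem ipForm_apply (u w : PW N) : M.ipForm u w = M.ip u w := by
  simp [ipForm, LinearMap.sum_apply, ip_eq_sum, cellForm_apply]

theorem ip_comm (u w : PW N) : M.ip u w = M.ip w u := by
  simp only [ip_eq_sum]
  exact Finset.sum_congr rfl fun j _ => cellIp_comm _ _ _ _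

theorem ip_add_left (u v w : PW N) : M.ip (u + v) w = M.ip u w + M.ip v w := by
  simp only [← ipForm_apply, map_add, LinearMap.add_apply]

theorem ip_add_right (u v w : PW N) : M.ip u (v + w) = M.ip u v + M.ip u w := by
  simp only [← ipForm_apply, map_add]

theorem ip_sub_left (u v w : PW N) : M.ip (u - v) w = M.ip u w - M.ip v w := by
  simp only [← ipForm_apply, map_sub, LinearMap.sub_apply]

theorem ip_sub_right (u v w : PW N) : M.ip u (v - w) = M.ip u v - M.ip u w := by
  simp only [← ipForm_apply, map_sub]

theorem ip_smul_left (c : ℝ) (u w : PW N) : M.ip (c • u) w = c * M.ip u w := by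
  simp only [← ipForm_apply, map_smul, LinearMap.smul_apply, smul_eq_mul]

theorem ip_smul_right (c : ℝ) (u w : PW N) : M.ip u (c • w) = c * M.ip u w := by
  simp only [← ipForm_apply, map_smul, smul_eq_mul]

theorem ip_self_nonneg (u : PW N) : 0 ≤ M.ip u u :=
  Finset.sum_nonneg fun j _ => cellIp_self_nonneg (M.left_lt_right j).le _

theorem eq_zero_of_ip_self_eq_zero {u : PW N} (h : M.ip u u = 0) : u = 0 := by
  funext j
  rw [ip_eq_sum, Finset.sum_eq_zero_iff_of_nonneg
    fun j _ => cellIp_self_nonneg (M.left_lt_right j).le _] at h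
  by_contra hj
  exact (cellIp_self_pos (M.left_lt_right j) hj).ne' (h j (Finset.mem_univ j))

/-- The `L²` norm. -/
def nrm (u : PW N) : ℝ := Real.sqrt (M.ip u u)

theorem nrm_nonneg (u : PW N) : 0 ≤ M.nrm u := Real.sqrt_nonneg _

theorem nrm_sq (u : PW N) : M.nrm u ^ 2 = M.ip u u := Real.sq_sqrt (M.ip_self_nonneg u)

theorem abs_ip_le (u w : PW N) : |M.ip u w| ≤ M.nrm u * M.nrm w := by
  have h := LinearMap.BilinForm.apply_mul_apply_le_of_forall_zero_le M.ipForm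
    (fun u => by rw [ipForm_apply]; exact M.ip_self_nonneg u) u w
  simp only [ipForm_apply] at h
  rw [M.ip_comm w u, ← sq] at h
  rw [nrm, nrm, ← Real.sqrt_mul (M.ip_self_nonneg u)]
  exact Real.abs_le_sqrt h

theorem ip_self_le_of_abs_le {f u : PW N} {B : ℝ}
    (h : ∀ j, ∀ x ∈ Set.Icc (M.left j) (M.right j), |(f j).eval x| ≤ B * |(u j).eval x|) :
    M.ip f f ≤ B ^ 2 * M.ip u u := by
  simp only [ip_eq_sum, Finset.mul_sum]
  refine Finset.sum_le_sum fun j _ => ?_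
  rw [cellIp, cellIp, ← intervalIntegral.integral_const_mul]
  refine intervalIntegral.integral_mono_on (M.left_lt_right j).le
    (intervalIntegrable_eval_mul _ _ _ _) ((intervalIntegrable_eval_mul _ _ _ _).const_mul _)
    fun x hx => ?_
  have := pow_le_pow_left₀ (abs_nonneg _) (h j x hx) 2
  rw [mul_pow, sq_abs, sq_abs] at this
  nlinarith

theorem nrm_le_of_abs_le {f u : PW N} {B : ℝ} (hB : 0 ≤ B)
    (h : ∀ j, ∀ x ∈ Set.Icc (M.left j) (M.right j), |(f j).eval x| ≤ B * |(u j).eval x|) :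
    M.nrm f ≤ B * M.nrm u := by
  rw [nrm, Real.sqrt_le_left (mul_nonneg hB (M.nrm_nonneg u)), mul_pow, nrm_sq]
  exact M.ip_self_le_of_abs_le h

theorem ip_const_const (c d : ℝ) : M.ip (const N c) (const N d) = c * d * L := by
  refine Eq.trans ?_ (congrArg (c * d * ·) M.sum_size)
  simp only [ip_eq_sum, Finset.mul_sum]
  refine Finset.sum_congr rfl fun j _ => ?_
  simp only [cellIp, const, eval_C, intervalIntegral.integral_const, smul_eq_mul, size]
  ring

theorem ip_const_right (u : PW N) (c : ℝ) :
    M.ip u (const N c) = c * M.ip u (const N 1) := by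
  rw [← M.ip_smul_right]
  congr 1
  funext j
  simp [const, smul_eq_C_mul]

theorem nrm_const_one : M.nrm (const N 1) = Real.sqrt L := by
  rw [nrm, ip_const_const, one_mul, one_mul]

/-- A function that is bounded by `B` has `L²` norm at most `B √L`. -/
theorem nrm_le_of_forall_abs_le {f : PW N} {B : ℝ} (hB : 0 ≤ B)
    (h : ∀ j, ∀ x ∈ Set.Icc (M.left j) (M.right j), |(f j).eval x| ≤ B) :
    M.nrm f ≤ B * Real.sqrt L := by
  rw [← M.nrm_const_one]
  refine M.nrm_le_of_abs_le hB fun j x hx => ?_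
  simpa [const] using h j x hx

/-- Multiplication by a bounded function. -/
theorem abs_ip_mul_le {f u w : PW N} {B : ℝ} (hB : 0 ≤ B)
    (h : ∀ j, ∀ x ∈ Set.Icc (M.left j) (M.right j), |(f j).eval x| ≤ B) :
    |M.ip (f * u) w| ≤ B * M.nrm u * M.nrm w := by
  refine (M.abs_ip_le _ _).trans (mul_le_mul_of_nonneg_right ?_ (M.nrm_nonneg w))
  refine M.nrm_le_of_abs_le hB fun j x hx => ?_
  rw [Pi.mul_apply, eval_mul, abs_mul]
  exact mul_le_mul_of_nonneg_right (h j x hx) (abs_nonneg _)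

theorem ip_single (u : PW N) (j : Fin N) (v : ℝ[X]) :
    M.ip u (Pi.single j v) = cellIp (M.left j) (M.right j) (u j) v := by
  rw [ip_eq_sum, Finset.sum_eq_single j]
  · simp
  · intro i _ hi
    simp [Pi.single_eq_of_ne hi, cellIp_zero_right]
  · simp

/-- Cauchy–Schwarz inequality between the cell sizes and the cell norms. -/
theorem sum_sqrt_size_mul_le (g : PW N) :
    ∑ j, Real.sqrt (M.size j * cellIp (M.left j) (M.right j) (g j) (g j))
      ≤ Real.sqrt L * M.nrm g := by
  have := Real.sum_sqrt_mul_sqrt_le Finset.univ (fun j => (M.size_pos j).le)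
    (fun j => cellIp_self_nonneg (M.left_lt_right j).le (g j))
  rw [M.sum_size] at this
  simpa only [Real.sqrt_mul (M.size_pos _).le, nrm, ip_eq_sum] using this

end Mesh

theorem const_mem_U (N m : ℕ) (c : ℝ) : const N c ∈ U N m := fun j => by simp [const]

theorem deriv_const (N : ℕ) (c : ℝ) : deriv (const N c) = 0 := by
  funext j; simp [deriv, const]

theorem deriv_add {N : ℕ} (u w : PW N) : deriv (u + w) = deriv u + deriv w := by
  funext j; simp [deriv]

theorem deriv_smul {N : ℕ} (c : ℝ) (u : PW N) : deriv (c • u) = c • deriv u := by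
  funext j; simp [deriv]

theorem deriv_sub {N : ℕ} (u w : PW N) : deriv (u - w) = deriv u - deriv w := by
  funext j; simp [deriv]

/-- The space `U_h^m` as a subspace. -/
def Usub (N m : ℕ) : Submodule ℝ (PW N) := Submodule.pi Set.univ fun _ => degreeLE ℝ m

theorem mem_Usub {N m : ℕ} {u : PW N} : u ∈ Usub N m ↔ u ∈ U N m := by
  simp [Usub, U, Submodule.mem_pi, mem_degreeLE, natDegree_le_iff_degree_le]

theorem U_sub {N m : ℕ} {u w : PW N} (hu : u ∈ U N m) (hw : w ∈ U N m) : u - w ∈ U N m :=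
  mem_Usub.1 (sub_mem (mem_Usub.2 hu) (mem_Usub.2 hw))

theorem U_smul {N m : ℕ} (c : ℝ) {u : PW N} (hu : u ∈ U N m) : c • u ∈ U N m :=
  mem_Usub.1 (Submodule.smul_mem _ c (mem_Usub.2 hu))

theorem single_mem_U {N m : ℕ} (j : Fin N) {v : ℝ[X]} (hv : v.natDegree ≤ m) :
    (Pi.single j v : PW N) ∈ U N m := by
  intro i
  rcases eq_or_ne i j with rfl | h
  · simpa using hv
  · simp [Pi.single_eq_of_ne h]

section Forms

variable {N : ℕ} [NeZero N] {L : ℝ} (M : Mesh N L)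

/-! ### Flux forms -/

theorem trace_add (s : Side) (u w : PW N) (j : Fin N) :
    trace M s (u + w) j = trace M s u j + trace M s w j := by cases s <;> simp [trace]

theorem trace_smul (s : Side) (c : ℝ) (u : PW N) (j : Fin N) :
    trace M s (c • u) j = c * trace M s u j := by cases s <;> simp [trace]

theorem jump_add (u w : PW N) (j : Fin N) : jump M (u + w) j = jump M u j + jump M w j := by
  simp only [jump, trace_add]; ring

theorem jump_smul (c : ℝ) (u : PW N) (j : Fin N) : jump M (c • u) j = c * jump M u j := by
  simp only [jump, trace_smul]; ring

theorem jump_const (c : ℝ) (j : Fin N) : jump M (const N c) j = 0 := by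
  simp [jump, trace, const]

/-- The flux form as a bilinear form. -/
def fluxB (s : Side) : PW N →ₗ[ℝ] PW N →ₗ[ℝ] ℝ :=
  LinearMap.mk₂ ℝ (fluxForm M s)
    (fun u v w => by
      simp only [fluxForm, trace_add, M.ip_add_left, add_mul, Finset.sum_add_distrib]; ring)
    (fun c u w => by
      simp only [fluxForm, trace_smul, M.ip_smul_left, mul_assoc, ← Finset.mul_sum, smul_eq_mul]
      ring)
    (fun u v w => by
      simp only [fluxForm, jump_add, deriv_add, M.ip_add_right, mul_add, Finset.sum_add_distrib]
      ring)
    (fun c u w => by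
      simp only [fluxForm, jump_smul, deriv_smul, M.ip_smul_right, smul_eq_mul,
        mul_left_comm _ c, ← Finset.mul_sum]
      ring)

theorem fluxB_apply (s : Side) (u w : PW N) : fluxB M s u w = fluxForm M s u w := rfl

theorem sum_shift (f : Fin N → ℝ) : ∑ j, f (j - 1) = ∑ j, f j :=
  Equiv.sum_comp (Equiv.subRight (1 : Fin N)) f

theorem sum_shift' (f : Fin N → ℝ) : ∑ j, f (j + 1) = ∑ j, f j :=
  Equiv.sum_comp (Equiv.addRight (1 : Fin N)) f

/-- Integration by parts on each cell. -/
theorem ip_deriv_add (u w : PW N) :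
    M.ip u (deriv w) + M.ip w (deriv u)
      = ∑ j, (trace M .minus u j * trace M .minus w j - trace M .plus u j * trace M .plus w j) := by
  have hcell : ∀ j, cellIp (M.left j) (M.right j) (u j) (derivative (w j))
      + cellIp (M.left j) (M.right j) (w j) (derivative (u j))
      = (u j).eval (M.right j) * (w j).eval (M.right j)
        - (u j).eval (M.left j) * (w j).eval (M.left j) := by
    intro j
    rw [cellIp, cellIp, ← intervalIntegral.integral_add (intervalIntegrable_eval_mul _ _ _ _)
      (intervalIntegrable_eval_mul _ _ _ _)]
    have := intervalIntegral.integral_eq_sub_of_hasDerivAt (a := M.left j) (b := M.right j)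
      (fun x _ => ((u j).hasDerivAt x).mul ((w j).hasDerivAt x))
      (Continuous.intervalIntegrable (by fun_prop) _ _)
    rw [Pi.mul_apply, Pi.mul_apply] at this
    rw [← this]
    congr 1
    ext x
    ring
  simp only [M.ip_eq_sum, deriv, ← Finset.sum_add_distrib, hcell]
  rw [Finset.sum_sub_distrib, Finset.sum_sub_distrib]
  congr 1
  exact (sum_shift fun j => (u j).eval (M.right j) * (w j).eval (M.right j)).symm

/-- The forms with opposite fluxes are adjoint to each other up to the sign. -/
theorem fluxForm_adjoint (s : Side) (u w : PW N) :
    fluxForm M s u w = -fluxForm M s.opp w u := by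
  have h := ip_deriv_add M u w
  have h2 : (∑ j, trace M s u j * jump M w j) + ∑ j, trace M s.opp w j * jump M u j
      = -∑ j, (trace M .minus u j * trace M .minus w j - trace M .plus u j * trace M .plus w j) := by
    rw [← Finset.sum_add_distrib, ← Finset.sum_neg_distrib]
    refine Finset.sum_congr rfl fun j _ => ?_
    cases s <;> simp only [jump, Side.opp] <;> ring
  simp only [fluxForm]
  linarith

theorem fluxForm_const_right (s : Side) (u : PW N) (c : ℝ) : fluxForm M s u (const N c) = 0 := by
  simp only [fluxForm, jump_const, deriv_const, mul_zero, Finset.sum_const_zero, zero_add]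
  rw [← M.ipForm_apply, map_zero]

theorem fluxForm_const_left (s : Side) (w : PW N) (c : ℝ) : fluxForm M s (const N c) w = 0 := by
  rw [fluxForm_adjoint, fluxForm_const_right, neg_zero]

/-- With this skew structure every transport term is a value of `aStar`, and the sum over the
Hermite modes telescopes. -/
theorem aForm_eq_aStar (T₀ : ℝ) (s : Side) (u w : PW N) :
    aForm M T₀ s u w = aStar M T₀ s w u := by
  rw [aForm, aStar, fluxForm_adjoint]; ring

/-- The interface of the cell `j` whose jump is controlled by the test functions supported in the
cell `j`, if the numerical flux is taken from the side `s`. -/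
def jumpIdx : Side → Fin N → Fin N
  | .minus, j => j
  | .plus, j => j + 1

/-- The neighbour of the cell `j` beyond the interface `jumpIdx s j`. -/
def neighbour : Side → Fin N → Fin N
  | .minus, j => j - 1
  | .plus, j => j + 1

theorem sum_jumpIdx (s : Side) (f : Fin N → ℝ) : ∑ j, f (jumpIdx s j) = ∑ j, f j := by
  cases s
  · rfl
  · exact sum_shift' f

theorem sum_neighbour (s : Side) (f : Fin N → ℝ) : ∑ j, f (neighbour s j) = ∑ j, f j := by
  cases s
  · exact sum_shift f
  · exact sum_shift' f

/-- After passing to the adjoint, the test function enters through its trace from the side opposite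
to `s`. A test function supported in one cell therefore meets one interface only, which is the
situation of `exists_local_stability`. -/
theorem fluxForm_single (s : Side) (w : PW N) (j : Fin N) :
    ∃ e, (e = M.left j ∨ e = M.right j) ∧ ∀ v : ℝ[X],
      v.eval e * jump M w (jumpIdx s j) + cellIp (M.left j) (M.right j) v (derivative (w j))
        = -fluxForm M s w (Pi.single j v) := by
  have hip : ∀ v, M.ip (Pi.single j v) (deriv w)
      = cellIp (M.left j) (M.right j) v (derivative (w j)) := fun v => by
    rw [M.ip_comm, M.ip_single, cellIp_comm]; rfl
  cases s
  · refine ⟨M.left j, Or.inl rfl, fun v => ?_⟩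
    rw [fluxForm_adjoint, neg_neg, fluxForm, hip]
    congr 1
    rw [Finset.sum_eq_single j]
    · simp [Side.opp, trace, jumpIdx]
    · intro i _ hi
      simp [Side.opp, trace, Pi.single_eq_of_ne hi]
    · simp
  · refine ⟨M.right j, Or.inr rfl, fun v => ?_⟩
    rw [fluxForm_adjoint, neg_neg, fluxForm, hip]
    congr 1
    rw [Finset.sum_eq_single (j + 1)]
    · simp [Side.opp, trace, jumpIdx]
    · intro i _ hi
      have : i - 1 ≠ j := fun h => hi (by rw [← h, sub_add_cancel])
      simp [Side.opp, trace, Pi.single_eq_of_ne this]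
    · simp

/-- Local stability of the discrete derivative: if `g` is the discrete derivative of `w`, then `g`
controls the broken derivative and the jumps of `w`. -/
theorem exists_flux_stability (m : ℕ) :
    ∃ C : ℝ, 1 ≤ C ∧ ∀ {N : ℕ} [NeZero N] {L : ℝ} (M : Mesh N L) (s : Side) (w g : PW N),
      w ∈ U N m → (∀ v ∈ U N m, fluxForm M s w v = M.ip g v) → ∀ j,
        cellIp (M.left j) (M.right j) (derivative (w j)) (derivative (w j))
          ≤ C * cellIp (M.left j) (M.right j) (g j) (g j) ∧
        jump M w (jumpIdx s j) ^ 2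
          ≤ C * (M.size j * cellIp (M.left j) (M.right j) (g j) (g j)) := by
  obtain ⟨C, hC, h⟩ := exists_local_stability m
  refine ⟨C, hC, fun {N} _ {L} M s w g hw hg j => ?_⟩
  obtain ⟨e, he, hflux⟩ := fluxForm_single M s w j
  refine h (M.left j) (M.right j) (M.left_lt_right j) e he (w j) (g j) (hw j) _ fun v hv => ?_
  rw [hflux, hg _ (single_mem_U j hv), M.ip_single]

/-! ### Bounds for functions of zero mean -/

theorem sq_eval_sub_le {a b : ℝ} (p : ℝ[X]) {x : ℝ} (hx : x ∈ Set.Icc a b) :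
    (p.eval x - p.eval a) ^ 2 ≤ (b - a) * cellIp a b (derivative p) (derivative p) := by
  have h1 : p.eval x - p.eval a = cellIp a x 1 (derivative p) := by
    rw [cellIp, ← intervalIntegral.integral_eq_sub_of_hasDerivAt (fun y _ => p.hasDerivAt y)
      (intervalIntegrable_eval _ _ _)]
    simp
  rw [h1]
  refine (cellIp_sq_le hx.1 _ _).trans ?_
  rw [cellIp_one_one]
  have h2 : cellIp a x (derivative p) (derivative p) ≤ cellIp a b (derivative p) (derivative p) :=
    intervalIntegral.integral_mono_interval le_rfl hx.1 hx.2
      (Filter.Eventually.of_forall fun y => mul_self_nonneg _)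
      (intervalIntegrable_eval_mul _ _ _ _)
  have := cellIp_self_nonneg hx.1 (derivative p)
  exact mul_le_mul (by linarith [hx.2]) h2 this (by linarith [hx.1, hx.2])

/-- The oscillation of a piecewise polynomial is controlled by the oscillation on the cells and by
the jumps. -/
theorem abs_eval_sub_le (u : PW N) (B : Fin N → ℝ)
    (hB : ∀ j, ∀ x ∈ Set.Icc (M.left j) (M.right j), |(u j).eval x - (u j).eval (M.left j)| ≤ B j)
    (j : Fin N) {x : ℝ} (hx : x ∈ Set.Icc (M.left j) (M.right j)) :
    |(u j).eval x - (u 0).eval (M.left 0)| ≤ ∑ i, B i + ∑ i, |jump M u i| := by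
  have hB0 : ∀ j, 0 ≤ B j := fun j =>
    (abs_nonneg _).trans (hB j _ (Set.left_mem_Icc.2 (M.left_lt_right j).le))
  -- Going from cell `0` to cell `n` means crossing each cell `i < n` and then the jump at its right
  -- end, which has index `i + 1`.
  have key : ∀ (n : ℕ) (hn : n < N),
      |(u ⟨n, hn⟩).eval (M.left ⟨n, hn⟩) - (u 0).eval (M.left 0)|
        ≤ ∑ i : Fin N with i.val < n, (B i + |jump M u (i + 1)|) := by
    intro n
    induction n with
    | zero =>
      intro hn
      have : (⟨0, hn⟩ : Fin N) = 0 := rfl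
      simp [this]
    | succ n ih =>
      intro hn
      have hn' : n < N := by omega
      have hidx : (⟨n, hn'⟩ : Fin N) + 1 = ⟨n + 1, hn⟩ := by
        apply Fin.ext
        rw [Fin.val_add_one_of_lt' (by simpa using hn)]
      have hfil : (Finset.univ.filter fun i : Fin N => i.val < n + 1)
          = insert ⟨n, hn'⟩ (Finset.univ.filter fun i : Fin N => i.val < n) := by
        ext i
        simp only [Finset.mem_filter, Finset.mem_univ, true_and, Finset.mem_insert, Fin.ext_iff]
        omega
      rw [hfil, Finset.sum_insert (by simp), hidx]
      have hj : jump M u ⟨n + 1, hn⟩ = (u ⟨n + 1, hn⟩).eval (M.left ⟨n + 1, hn⟩)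
          - (u ⟨n, hn'⟩).eval (M.right ⟨n, hn'⟩) := by
        rw [← hidx]
        simp [jump, trace]
      have h1 := ih hn'
      have h2 := hB ⟨n, hn'⟩ _ (Set.right_mem_Icc.2 (M.left_lt_right _).le)
      have h3 := le_abs_self (jump M u ⟨n + 1, hn⟩)
      have h4 := neg_abs_le (jump M u ⟨n + 1, hn⟩)
      rw [abs_le] at h1 h2 ⊢
      constructor <;> linarith [h1.1, h1.2, h2.1, h2.2]
  have h1 := key j.1 j.2
  have h2 := hB j x hx
  have hsum : B j + ∑ i : Fin N with i.val < j.1, (B i + |jump M u (i + 1)|)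
      ≤ ∑ i, B i + ∑ i, |jump M u i| := by
    rw [Finset.sum_add_distrib, ← add_assoc]
    refine add_le_add ?_ ?_
    · rw [← Finset.sum_insert (f := B) (a := j) (by simp)]
      exact Finset.sum_le_sum_of_subset_of_nonneg (Finset.subset_univ _) fun i _ _ => hB0 i
    · rw [← sum_shift' fun i => |jump M u i|]
      exact Finset.sum_le_sum_of_subset_of_nonneg (Finset.subset_univ _)
        fun i _ _ => abs_nonneg _
  refine le_trans ?_ hsum
  simp only [Fin.eta] at h1
  calc |(u j).eval x - (u 0).eval (M.left 0)|
      = |((u j).eval x - (u j).eval (M.left j))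
          + ((u j).eval (M.left j) - (u 0).eval (M.left 0))| := by congr 1; ring
    _ ≤ _ := (abs_add_le _ _).trans (add_le_add h2 h1)

/-- Poincaré inequality in the maximum norm. -/
theorem abs_eval_le_of_mean_zero (hL : 0 < L) {u : PW N} (hu : M.ip u (const N 1) = 0)
    (j : Fin N) {x : ℝ} (hx : x ∈ Set.Icc (M.left j) (M.right j)) :
    |(u j).eval x| ≤ 2 * (Real.sqrt L * M.nrm (deriv u) + ∑ i, |jump M u i|) := by
  set B : Fin N → ℝ := fun j =>
    Real.sqrt (M.size j * cellIp (M.left j) (M.right j) (deriv u j) (deriv u j)) with hB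
  set R := Real.sqrt L * M.nrm (deriv u) + ∑ i, |jump M u i| with hR
  have hosc : ∀ j, ∀ x ∈ Set.Icc (M.left j) (M.right j),
      |(u j).eval x - (u 0).eval (M.left 0)| ≤ R := by
    intro j x hx
    refine (abs_eval_sub_le M u B (fun j x hx => ?_) j hx).trans ?_
    · exact Real.abs_le_sqrt (sq_eval_sub_le (u j) hx)
    · exact add_le_add_left (M.sum_sqrt_size_mul_le (deriv u)) _
  have hR0 : 0 ≤ R := by
    refine add_nonneg (mul_nonneg (Real.sqrt_nonneg _) (M.nrm_nonneg _)) ?_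
    exact Finset.sum_nonneg fun i _ => abs_nonneg _
  set c := (u 0).eval (M.left 0) with hc
  -- Since `u` has zero mean, `u - c` has integral `-c L`, while it is bounded by `R` everywhere.
  have hcL : |c| ≤ R := by
    have h1 : M.nrm (u - const N c) ≤ R * Real.sqrt L :=
      M.nrm_le_of_forall_abs_le hR0 fun j x hx => by simpa [const] using hosc j x hx
    have h2 : M.ip (u - const N c) (const N 1) = -(c * L) := by
      rw [M.ip_sub_left, hu, M.ip_const_const]; ring
    have h3 := M.abs_ip_le (u - const N c) (const N 1)
    rw [h2, abs_neg, abs_mul, abs_of_pos hL, M.nrm_const_one] at h3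
    have h4 : |c| * L ≤ R * L :=
      calc |c| * L ≤ _ := h3
        _ ≤ R * Real.sqrt L * Real.sqrt L := by gcongr
        _ = R * L := by rw [mul_assoc, Real.mul_self_sqrt hL.le]
    exact le_of_mul_le_mul_right h4 hL
  calc |(u j).eval x| = |((u j).eval x - c) + c| := by rw [sub_add_cancel]
    _ ≤ R + R := (abs_add_le _ _).trans (add_le_add (hosc j x hx) hcL)
    _ = 2 * R := by ring

/-- A function of zero mean is controlled by its discrete derivative. -/
theorem exists_flux_sup_bound (m : ℕ) {L : ℝ} (hL : 0 < L) :
    ∃ K : ℝ, 1 ≤ K ∧ ∀ {N : ℕ} [NeZero N] (M : Mesh N L) (s : Side) (w g : PW N),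
      w ∈ U N m → M.ip w (const N 1) = 0 → (∀ v ∈ U N m, fluxForm M s w v = M.ip g v) →
      ∀ j, ∀ x ∈ Set.Icc (M.left j) (M.right j), |(w j).eval x| ≤ K * M.nrm g := by
  obtain ⟨C, hC, h⟩ := exists_flux_stability m
  refine ⟨max 1 (4 * (Real.sqrt C * Real.sqrt L)), le_max_left _ _,
    fun {N} _ M s w g hw hmean hg j x hx => ?_⟩
  have hst := h M s w g hw hg
  refine (abs_eval_le_of_mean_zero M hL hmean j hx).trans ?_
  have h1 : M.nrm (deriv w) ≤ Real.sqrt C * M.nrm g := by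
    rw [Mesh.nrm, Mesh.nrm, ← Real.sqrt_mul (by linarith)]
    refine Real.sqrt_le_sqrt ?_
    simp only [M.ip_eq_sum, Finset.mul_sum]
    exact Finset.sum_le_sum fun j _ => (hst j).1
  have h2 : ∑ i, |jump M w i| ≤ Real.sqrt C * (Real.sqrt L * M.nrm g) := by
    rw [← sum_jumpIdx s fun i => |jump M w i|]
    refine le_trans ?_ (mul_le_mul_of_nonneg_left (M.sum_sqrt_size_mul_le g) (Real.sqrt_nonneg C))
    rw [Finset.mul_sum]
    refine Finset.sum_le_sum fun j _ => ?_
    rw [← Real.sqrt_mul (by linarith)]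
    exact Real.abs_le_sqrt (hst j).2
  calc 2 * (Real.sqrt L * M.nrm (deriv w) + ∑ i, |jump M w i|)
      ≤ 2 * (Real.sqrt L * (Real.sqrt C * M.nrm g) + Real.sqrt C * (Real.sqrt L * M.nrm g)) := by
        gcongr
    _ = 4 * (Real.sqrt C * Real.sqrt L) * M.nrm g := by ring
    _ ≤ _ := mul_le_mul_of_nonneg_right (le_max_right _ _) (M.nrm_nonneg g)

/-- The discrete derivative with one flux controls the discrete derivative with the opposite flux
(here in its adjoint form). -/
theorem exists_flux_opp_bound (m : ℕ) (Cqu : ℝ) (hCqu : 0 < Cqu) :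
    ∃ K : ℝ, 1 ≤ K ∧ ∀ {N : ℕ} [NeZero N] {L : ℝ} (M : Mesh N L), M.QuasiUniform Cqu →
      ∀ (s : Side) (w g v : PW N), w ∈ U N m → v ∈ U N m →
      (∀ v ∈ U N m, fluxForm M s w v = M.ip g v) →
      |fluxForm M s v w| ≤ K * (M.nrm v * M.nrm g) := by
  obtain ⟨C, hC, h⟩ := exists_flux_stability m
  obtain ⟨C₁, hC₁, hinv⟩ := exists_sq_eval_le m
  refine ⟨max 1 (Real.sqrt (C₁ * C * Cqu) + Real.sqrt C), le_max_left _ _,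
    fun {N} _ {L} M hqu s w g v hw hv hg => ?_⟩
  have hst := h M s w g hw hg
  have h1 : M.nrm (deriv w) ≤ Real.sqrt C * M.nrm g := by
    rw [Mesh.nrm, Mesh.nrm, ← Real.sqrt_mul (by linarith)]
    refine Real.sqrt_le_sqrt ?_
    simp only [M.ip_eq_sum, Finset.mul_sum]
    exact Finset.sum_le_sum fun j _ => (hst j).1
  set γ : Fin N → ℝ := fun j => cellIp (M.left j) (M.right j) (g j) (g j) with hγ
  set ν : Fin N → ℝ := fun j => cellIp (M.left j) (M.right j) (v j) (v j) with hν
  have hγ0 : ∀ j, 0 ≤ γ j := fun j => cellIp_self_nonneg (M.left_lt_right j).le _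
  have hν0 : ∀ j, 0 ≤ ν j := fun j => cellIp_self_nonneg (M.left_lt_right j).le _
  -- The trace of `v` is taken in the cell beyond the interface, whereas the jump of `w` is bounded
  -- through the size of cell `j`. Quasi-uniformity is needed exactly to compare these two sizes.
  have htr : ∀ j, M.size (neighbour s j) * trace M s v (jumpIdx s j) ^ 2
      ≤ C₁ * ν (neighbour s j) := by
    intro j
    cases s
    · exact hinv _ (hv _) _ _ (M.left_lt_right _) _ (Set.right_mem_Icc.2 (M.left_lt_right _).le)
    · exact hinv _ (hv _) _ _ (M.left_lt_right _) _ (Set.left_mem_Icc.2 (M.left_lt_right _).le)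
  have hterm : ∀ j, |trace M s v (jumpIdx s j) * jump M w (jumpIdx s j)|
      ≤ Real.sqrt (C₁ * C * Cqu) * (Real.sqrt (ν (neighbour s j)) * Real.sqrt (γ j)) := by
    intro j
    rw [← Real.sqrt_mul (hν0 _), ← Real.sqrt_mul (by positivity)]
    refine Real.abs_le_sqrt ?_
    have hs := M.size_pos (neighbour s j)
    have e1 := htr j
    have e2 := (hst j).2
    have e3 := hqu j (neighbour s j)
    have e4 : jump M w (jumpIdx s j) ^ 2 ≤ C * (Cqu * M.size (neighbour s j) * γ j) :=
      e2.trans (by gcongr; exact hγ0 j)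
    refine le_of_mul_le_mul_left ?_ hs
    calc M.size (neighbour s j) * (trace M s v (jumpIdx s j) * jump M w (jumpIdx s j)) ^ 2
        = (M.size (neighbour s j) * trace M s v (jumpIdx s j) ^ 2)
            * jump M w (jumpIdx s j) ^ 2 := by ring
      _ ≤ (C₁ * ν (neighbour s j)) * (C * (Cqu * M.size (neighbour s j) * γ j)) := by
          refine mul_le_mul e1 e4 (sq_nonneg _) ?_
          have := hν0 (neighbour s j)
          positivity
      _ = _ := by ring
  have hsum : |∑ j, trace M s v j * jump M w j|
      ≤ Real.sqrt (C₁ * C * Cqu) * (M.nrm v * M.nrm g) := by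
    refine (Finset.abs_sum_le_sum_abs _ _).trans ?_
    rw [← sum_jumpIdx s fun j => |trace M s v j * jump M w j|]
    refine (Finset.sum_le_sum fun j _ => hterm j).trans ?_
    rw [← Finset.mul_sum]
    refine mul_le_mul_of_nonneg_left ?_ (Real.sqrt_nonneg _)
    have := Real.sum_sqrt_mul_sqrt_le Finset.univ (fun j => hν0 (neighbour s j)) hγ0
    rwa [sum_neighbour s ν] at this
  have hfin : |fluxForm M s v w| ≤ (Real.sqrt (C₁ * C * Cqu) + Real.sqrt C)
      * (M.nrm v * M.nrm g) := by
    rw [fluxForm]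
    refine (abs_add_le _ _).trans ?_
    rw [add_mul]
    refine add_le_add hsum ((M.abs_ip_le _ _).trans ?_)
    calc M.nrm v * M.nrm (deriv w) ≤ M.nrm v * (Real.sqrt C * M.nrm g) :=
          mul_le_mul_of_nonneg_left h1 (M.nrm_nonneg v)
      _ = _ := by ring
  refine hfin.trans (mul_le_mul_of_nonneg_right (le_max_right _ _) ?_)
  exact mul_nonneg (M.nrm_nonneg v) (M.nrm_nonneg g)

end Forms

/-! ### Orthonormality of the Hermite functions -/

/-- The unnormalised Gaussian weight. -/
def gauss (x : ℝ) : ℝ := Real.exp (-(x ^ 2 / 2))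

theorem integrable_eval_mul_gauss (p : ℝ[X]) :
    MeasureTheory.Integrable fun x => p.eval x * gauss x := by
  have hmon : ∀ n : ℕ, MeasureTheory.Integrable fun x : ℝ => x ^ n * gauss x := by
    intro n
    have := integrable_rpow_mul_exp_neg_mul_sq (b := 1 / 2) (by norm_num) (s := n)
      (by have : (0 : ℝ) ≤ n := n.cast_nonneg
          linarith)
    refine this.congr (Filter.Eventually.of_forall fun x => ?_)
    simp only [Real.rpow_natCast, gauss]
    congr 2
    ring
  have : (fun x => p.eval x * gauss x)
      = fun x => ∑ i ∈ Finset.range (p.natDegree + 1), p.coeff i * (x ^ i * gauss x) := by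
    ext x
    rw [p.eval_eq_sum_range, Finset.sum_mul]
    exact Finset.sum_congr rfl fun i _ => mul_assoc _ _ _
  rw [this]
  exact MeasureTheory.integrable_finsetSum _ fun i _ => (hmon i).const_mul _

theorem hasDerivAt_gauss (x : ℝ) : HasDerivAt gauss (-x * gauss x) x := by
  have h : HasDerivAt (fun y : ℝ => -(y ^ 2 / 2)) (-x) x := by
    refine ((hasDerivAt_pow 2 x).div_const 2).neg.congr_deriv ?_
    simp
  have h2 := h.exp
  rw [mul_comm] at h2
  exact h2

/-- Integration by parts against the Gaussian weight. -/
theorem integral_mul_gauss_by_parts (p q : ℝ[X]) :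
    ∫ x, ((X * p - derivative p) * q).eval x * gauss x
      = ∫ x, (p * derivative q).eval x * gauss x := by
  have h := MeasureTheory.integral_eq_zero_of_hasDerivAt_of_integrable
    (f := fun x => (p * q).eval x * gauss x)
    (f' := fun x => (p * derivative q).eval x * gauss x
      - ((X * p - derivative p) * q).eval x * gauss x)
    (fun x => by
      refine (((p * q).hasDerivAt x).mul (hasDerivAt_gauss x)).congr_deriv ?_
      simp only [derivative_mul, eval_add, eval_mul, eval_sub, eval_X]
      ring)
    ((integrable_eval_mul_gauss _).sub (integrable_eval_mul_gauss _))
    (integrable_eval_mul_gauss _)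
  rw [MeasureTheory.integral_sub (integrable_eval_mul_gauss _) (integrable_eval_mul_gauss _)] at h
  linarith

/-- The Hermite polynomials with real coefficients. -/
def hermiteR (k : ℕ) : ℝ[X] := (hermite k).map (Int.castRingHom ℝ)

theorem hermiteR_succ (k : ℕ) :
    hermiteR (k + 1) = X * hermiteR k - derivative (hermiteR k) := by
  simp [hermiteR, hermite_succ, derivative_map]

theorem natDegree_hermiteR (k : ℕ) : (hermiteR k).natDegree = k := by
  rw [hermiteR, natDegree_map_eq_of_injective (RingHom.injective_int _), natDegree_hermite]

theorem hermiteN_eq (k : ℕ) (ξ : ℝ) :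
    hermiteN k ξ = (hermiteR k).eval ξ / Real.sqrt (k.factorial : ℝ) := by
  rw [hermiteN, hermiteR, eval_map, aeval_def]
  rfl

/-- The raising operator `p ↦ X p - p'` is the adjoint of the derivative for the Gaussian weight.
Orthogonality then follows from degrees, and the norm from the `n`-th derivative of a monic
polynomial of degree `n`. -/
theorem integral_hermiteR_mul (n : ℕ) (q : ℝ[X]) :
    ∫ x, (hermiteR n * q).eval x * gauss x = ∫ x, (derivative^[n] q).eval x * gauss x := by
  induction n generalizing q with
  | zero => simp [hermiteR]
  | succ n ih => rw [hermiteR_succ, integral_mul_gauss_by_parts, ih, Function.iterate_succ_apply]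

theorem integral_gauss : ∫ x, gauss x = Real.sqrt (2 * Real.pi) := by
  have := integral_gaussian (1 / 2)
  rw [show Real.pi / (1 / 2) = 2 * Real.pi by ring] at this
  rw [← this]
  congr 1
  ext x
  simp only [gauss]
  congr 1
  ring

theorem integral_hermiteR_mul_of_lt {j k : ℕ} (h : j < k) :
    ∫ x, (hermiteR k * hermiteR j).eval x * gauss x = 0 := by
  rw [integral_hermiteR_mul, iterate_derivative_eq_zero (by rwa [natDegree_hermiteR])]
  simp

theorem integral_hermiteR_mul_self (k : ℕ) :
    ∫ x, (hermiteR k * hermiteR k).eval x * gauss x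
      = k.factorial * Real.sqrt (2 * Real.pi) := by
  have h : derivative^[k] (hermiteR k) = C (k.factorial : ℝ) := by
    have hd : (derivative^[k] (hermiteR k)).natDegree ≤ 0 :=
      (natDegree_iterate_derivative _ _).trans (by rw [natDegree_hermiteR, Nat.sub_self])
    rw [eq_C_of_natDegree_le_zero hd, coeff_iterate_derivative, zero_add, hermiteR, coeff_map,
      coeff_hermite_self, Nat.descFactorial_self]
    simp
  rw [integral_hermiteR_mul, h]
  simp only [eval_C]
  rw [MeasureTheory.integral_const_mul, integral_gauss]

theorem integral_hermiteN_mul (j k : ℕ) :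
    ∫ x, hermiteN j x * hermiteN k x * gauss x
      = if j = k then Real.sqrt (2 * Real.pi) else 0 := by
  have h : ∀ x, hermiteN j x * hermiteN k x * gauss x
      = (Real.sqrt (j.factorial : ℝ) * Real.sqrt (k.factorial : ℝ))⁻¹
        * ((hermiteR j * hermiteR k).eval x * gauss x) := by
    intro x
    rw [hermiteN_eq, hermiteN_eq, eval_mul, div_mul_div_comm, div_eq_inv_mul]
    ring
  simp only [h]
  rw [MeasureTheory.integral_const_mul]
  split_ifs with hjk
  · subst hjk
    rw [integral_hermiteR_mul_self, Real.mul_self_sqrt (by positivity),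
      inv_mul_cancel_left₀ (by positivity)]
  · rcases lt_or_gt_of_ne hjk with h1 | h1
    · rw [mul_comm (hermiteR j), integral_hermiteR_mul_of_lt h1, mul_zero]
    · rw [integral_hermiteR_mul_of_lt h1, mul_zero]

theorem integrable_hermiteN_mul (j k : ℕ) :
    MeasureTheory.Integrable fun x => hermiteN j x * hermiteN k x * gauss x := by
  refine ((integrable_eval_mul_gauss (hermiteR j * hermiteR k)).const_mul
    (Real.sqrt (j.factorial : ℝ) * Real.sqrt (k.factorial : ℝ))⁻¹).congr
    (Filter.Eventually.of_forall fun x => ?_)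
  simp only [hermiteN_eq, eval_mul, div_eq_inv_mul]
  ring

theorem integral_sq_sum_hermiteN (n : ℕ) (c : ℕ → ℝ) :
    ∫ x, (∑ k ∈ Finset.range n, c k * hermiteN k x) ^ 2 * gauss x
      = Real.sqrt (2 * Real.pi) * ∑ k ∈ Finset.range n, c k ^ 2 := by
  have h : ∀ x, (∑ k ∈ Finset.range n, c k * hermiteN k x) ^ 2 * gauss x
      = ∑ j ∈ Finset.range n, ∑ k ∈ Finset.range n,
        (c j * c k) * (hermiteN j x * hermiteN k x * gauss x) := by
    intro x
    rw [sq, Finset.sum_mul_sum, Finset.sum_mul]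
    refine Finset.sum_congr rfl fun j _ => ?_
    rw [Finset.sum_mul]
    exact Finset.sum_congr rfl fun k _ => by ring
  simp only [h]
  rw [MeasureTheory.integral_finsetSum _ fun j _ => MeasureTheory.integrable_finsetSum _
    fun k _ => (integrable_hermiteN_mul j k).const_mul _, Finset.mul_sum]
  refine Finset.sum_congr rfl fun j hj => ?_
  rw [MeasureTheory.integral_finsetSum _ fun k _ => (integrable_hermiteN_mul j k).const_mul _]
  simp only [MeasureTheory.integral_const_mul, integral_hermiteN_mul]
  rw [Finset.sum_eq_single_of_mem j hj fun k _ hk => by rw [if_neg (Ne.symm hk), mul_zero],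
    if_pos rfl]
  ring

theorem maxwellian_pos {T₀ : ℝ} (hT₀ : 0 < T₀) (v : ℝ) : 0 < maxwellian T₀ v := by
  have := Real.pi_pos
  unfold maxwellian
  positivity

theorem maxwellian_eq {T₀ : ℝ} (hT₀ : 0 < T₀) (v : ℝ) :
    maxwellian T₀ v
      = (Real.sqrt (2 * Real.pi) * Real.sqrt T₀)⁻¹ * gauss (v / Real.sqrt T₀) := by
  rw [maxwellian, gauss, Real.sqrt_mul (by positivity), div_pow, Real.sq_sqrt hT₀.le]
  congr 2
  field_simp

/-- Parseval identity in the velocity variable. -/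
theorem integral_sq_sum_hermiteFun {T₀ ρ : ℝ} (hT₀ : 0 < T₀) (hρ : 0 < ρ) (n : ℕ)
    (c : ℕ → ℝ) :
    ∫ v, (∑ k ∈ Finset.range n, c k * hermiteFun T₀ k v) ^ 2 * (fInf T₀ ρ v)⁻¹
      = ρ⁻¹ * ∑ k ∈ Finset.range n, c k ^ 2 := by
  have hs : 0 < Real.sqrt T₀ := Real.sqrt_pos.2 hT₀
  have hpi : 0 < Real.sqrt (2 * Real.pi) := Real.sqrt_pos.2 (by have := Real.pi_pos; positivity)
  set g : ℝ → ℝ := fun x => (∑ k ∈ Finset.range n, c k * hermiteN k x) ^ 2 * gauss x with hg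
  have h : ∀ v, (∑ k ∈ Finset.range n, c k * hermiteFun T₀ k v) ^ 2 * (fInf T₀ ρ v)⁻¹
      = ρ⁻¹ * (Real.sqrt (2 * Real.pi) * Real.sqrt T₀)⁻¹ * g (v / Real.sqrt T₀) := by
    intro v
    have hM := (maxwellian_pos hT₀ v).ne'
    simp only [hermiteFun, ← mul_assoc, ← Finset.sum_mul, fInf]
    rw [mul_inv, mul_pow]
    calc _ = ρ⁻¹ * maxwellian T₀ v
          * (∑ k ∈ Finset.range n, c k * hermiteN k (v / Real.sqrt T₀)) ^ 2 := by field_simp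
      _ = _ := by rw [maxwellian_eq hT₀]; ring
  simp only [h]
  rw [MeasureTheory.integral_const_mul, MeasureTheory.Measure.integral_comp_div g,
    integral_sq_sum_hermiteN, abs_of_pos hs, smul_eq_mul]
  field_simp

theorem hermiteFun_zero (T₀ v : ℝ) : hermiteFun T₀ 0 v = maxwellian T₀ v := by
  simp [hermiteFun, hermiteN]

/-! ### The energy in Hermite modes -/

section Energy

variable {N : ℕ} {L : ℝ}

/-- The Hermite modes of the perturbation `f_h - f_∞`. -/
def pert (ρ : ℝ) (D : ℕ → ℝ → PW N) : ℕ → ℝ → PW N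
  | 0, t => D 0 t - const N ρ
  | k + 1, t => D (k + 1) t

theorem fh_sub_fInf (T₀ ρ : ℝ) (NH : ℕ) (D : ℕ → ℝ → PW N) (t : ℝ) (j : Fin N) (x v : ℝ) :
    fh T₀ NH D t j x v - fInf T₀ ρ v
      = ∑ k ∈ Finset.range (NH + 1), (pert ρ D k t j).eval x * hermiteFun T₀ k v := by
  rw [fh, Finset.sum_range_succ', Finset.sum_range_succ']
  simp only [pert, hermiteFun_zero, fInf, const, Pi.sub_apply, eval_sub, eval_C]
  ring

/-- The energy in terms of the Hermite modes. -/
theorem energy_eq [NeZero N] (M : Mesh N L) {T₀ ρ : ℝ} (hT₀ : 0 < T₀) (hρ : 0 < ρ) (NH : ℕ)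
    (D : ℕ → ℝ → PW N) (E : ℝ → PW N) (t : ℝ) :
    ρ * energy M T₀ ρ NH D E t
      = 1 / 2 * ∑ k ∈ Finset.range (NH + 1), M.ip (pert ρ D k t) (pert ρ D k t)
        + ρ / (2 * T₀) * M.ip (E t) (E t) := by
  have h : ∑ j, ∫ x in M.left j..M.right j, ∫ v : ℝ,
      (fh T₀ NH D t j x v - fInf T₀ ρ v) ^ 2 * (fInf T₀ ρ v)⁻¹
      = ρ⁻¹ * ∑ k ∈ Finset.range (NH + 1), M.ip (pert ρ D k t) (pert ρ D k t) := by
    simp only [M.ip_eq_sum]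
    rw [Finset.sum_comm, Finset.mul_sum]
    refine Finset.sum_congr rfl fun j _ => ?_
    simp only [fh_sub_fInf, integral_sq_sum_hermiteFun hT₀ hρ]
    rw [intervalIntegral.integral_const_mul, intervalIntegral.integral_finsetSum]
    · simp only [cellIp, sq]
    · intro k _
      exact Continuous.intervalIntegrable (by fun_prop) _ _
  rw [energy, h]
  field_simp

end Energy

/-! ### The discrete primitive -/

instance finiteDimensional_Usub (N m : ℕ) : FiniteDimensional ℝ (Usub N m) := by
  let f : Usub N m →ₗ[ℝ] (Fin N → Fin (m + 1) → ℝ) :=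
    { toFun := fun u j i => (u.1 j).coeff i
      map_add' := fun u w => by ext; simp
      map_smul' := fun c u => by ext; simp }
  refine Module.Finite.of_injective f fun u w h => ?_
  apply Subtype.ext
  funext j
  ext i
  rcases lt_or_ge i (m + 1) with hi | hi
  · exact congrFun (congrFun h j) ⟨i, hi⟩
  · rw [coeff_eq_zero_of_natDegree_lt ((mem_Usub.1 u.2 j).trans_lt hi),
      coeff_eq_zero_of_natDegree_lt ((mem_Usub.1 w.2 j).trans_lt hi)]

/-- Splitting off the mean value. -/
theorem exists_mean_decomposition {N : ℕ} {L : ℝ} (M : Mesh N L) (hL : 0 < L) {m : ℕ} {v : PW N} (hv : v ∈ U N m) :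
    ∃ v₀ ∈ V M m, ∃ c : ℝ, v = v₀ + const N c := by
  refine ⟨v - const N (M.ip v (const N 1) / L), ⟨U_sub hv (const_mem_U N m _), ?_⟩,
    M.ip v (const N 1) / L, (sub_add_cancel _ _).symm⟩
  rw [M.ip_sub_left, M.ip_const_const]
  field_simp
  ring

theorem eq_zero_of_forall_abs_le_zero {N : ℕ} {L : ℝ} (M : Mesh N L) {u : PW N}
    (h : ∀ j, ∀ x ∈ Set.Icc (M.left j) (M.right j), |(u j).eval x| ≤ 0) : u = 0 := by
  apply M.eq_zero_of_ip_self_eq_zero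
  have h1 := M.nrm_le_of_forall_abs_le le_rfl h
  rw [zero_mul] at h1
  rw [← M.nrm_sq, le_antisymm h1 (M.nrm_nonneg u)]
  ring

theorem U_deriv {N m : ℕ} {u : PW N} (hu : u ∈ U N (m + 1)) : deriv u ∈ U N m := fun j =>
  (natDegree_derivative_le _).trans (Nat.sub_le_of_le_add (hu j))

theorem eq_sum_monomials {N m : ℕ} {u : PW N} (hu : u ∈ U N m) :
    u = ∑ j, ∑ i ∈ Finset.range (m + 1), (u j).coeff i • (Pi.single j (X ^ i) : PW N) := by
  funext l
  rw [Finset.sum_apply, Finset.sum_eq_single l]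
  · rw [Finset.sum_apply]
    conv_lhs => rw [(u l).as_sum_range' (m + 1) (Nat.lt_succ_of_le (hu l))]
    refine Finset.sum_congr rfl fun i _ => ?_
    rw [Pi.smul_apply, Pi.single_eq_same, ← C_mul_X_pow_eq_monomial, smul_eq_C_mul]
  · intro j _ hj
    rw [Finset.sum_apply]
    refine Finset.sum_eq_zero fun i _ => ?_
    rw [Pi.smul_apply, Pi.single_eq_of_ne (Ne.symm hj), smul_zero]
  · simp

section Forms

variable {N : ℕ} [NeZero N] {L : ℝ} (M : Mesh N L)

theorem fluxForm_add_right (s : Side) (u v w : PW N) :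
    fluxForm M s u (v + w) = fluxForm M s u v + fluxForm M s u w := by
  simp only [← fluxB_apply, map_add]

theorem fluxForm_sub_left (s : Side) (u v w : PW N) :
    fluxForm M s (u - v) w = fluxForm M s u w - fluxForm M s v w := by
  simp only [← fluxB_apply, map_sub, LinearMap.sub_apply]

theorem fluxForm_neg_left (s : Side) (u w : PW N) :
    fluxForm M s (-u) w = -fluxForm M s u w := by
  simp only [← fluxB_apply, map_neg, LinearMap.neg_apply]

/-- Test functions of zero mean suffice for data of zero mean. -/
theorem fluxForm_eq_of_forall_mem_V (hL : 0 < L) {m : ℕ} {s : Side} {w g : PW N}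
    (hg : M.ip g (const N 1) = 0) (h : ∀ v ∈ V M m, fluxForm M s w v = M.ip g v) :
    ∀ v ∈ U N m, fluxForm M s w v = M.ip g v := by
  intro v hv
  obtain ⟨v₀, hv₀, c, rfl⟩ := exists_mean_decomposition M hL hv
  rw [fluxForm_add_right, fluxForm_const_right, h v₀ hv₀, M.ip_add_right, M.ip_const_right g c,
    hg, mul_zero]

/-- A function of zero mean whose discrete derivative vanishes is zero. -/
theorem eq_zero_of_fluxForm_eq_zero (hL : 0 < L) {m : ℕ} {s : Side} {w : PW N} (hw : w ∈ V M m)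
    (h : ∀ v ∈ U N m, fluxForm M s w v = 0) : w = 0 := by
  obtain ⟨K, _, hK⟩ := exists_flux_sup_bound m hL
  refine eq_zero_of_forall_abs_le_zero M fun j x hx => ?_
  have := hK M s w 0 hw.1 hw.2 (fun v hv => by
    rw [h v hv, ← M.ipForm_apply, map_zero, LinearMap.zero_apply]) j x hx
  simpa [Mesh.nrm, ← M.ipForm_apply] using this

/-- Existence of a primitive of zero mean for the discrete derivative, depending linearly on the
data. -/
theorem exists_discrete_primitive (hL : 0 < L) (m : ℕ) (s : Side) :
    ∃ S : PW N →ₗ[ℝ] PW N, (∀ g, S g ∈ V M m) ∧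
      ∀ g, M.ip g (const N 1) = 0 → ∀ v ∈ U N m, fluxForm M s (S g) v = M.ip g v := by
  let V₀ : Submodule ℝ (PW N) := Usub N m ⊓ LinearMap.ker (M.ipForm (const N 1))
  have hV₀ : ∀ v, v ∈ V₀ ↔ v ∈ V M m := fun v => by
    rw [Submodule.mem_inf, mem_Usub, LinearMap.mem_ker, M.ipForm_apply, M.ip_comm]
    rfl
  have : FiniteDimensional ℝ V₀ :=
    Submodule.finiteDimensional_of_le (inf_le_left : V₀ ≤ Usub N m)
  let T : V₀ →ₗ[ℝ] Module.Dual ℝ V₀ := (fluxB M s).compl₁₂ V₀.subtype V₀.subtype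
  have hT : ∀ w v : V₀, T w v = fluxForm M s w v := fun w v => rfl
  -- Trial and test spaces coincide and are finite-dimensional, so uniqueness, which comes from the
  -- maximum-norm bound, gives existence.
  have hinj : Function.Injective T := by
    rw [← LinearMap.ker_eq_bot, LinearMap.ker_eq_bot']
    intro w hw
    apply Subtype.ext
    refine eq_zero_of_fluxForm_eq_zero M hL (s := s) ((hV₀ _).1 w.2) fun v hv => ?_
    rw [fluxForm_eq_of_forall_mem_V M hL (g := 0) (m := m)
      (by rw [← M.ipForm_apply, map_zero, LinearMap.zero_apply]) _ v hv]
    · rw [← M.ipForm_apply, map_zero, LinearMap.zero_apply]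
    · intro v hv
      rw [← hT w ⟨v, (hV₀ v).2 hv⟩, hw, ← M.ipForm_apply, map_zero]
      rfl
  let e : V₀ ≃ₗ[ℝ] Module.Dual ℝ V₀ :=
    LinearEquiv.ofInjectiveOfFinrankEq T hinj Subspace.dual_finrank_eq.symm
  have he : ∀ w, e w = T w := fun w => rfl
  let R : PW N →ₗ[ℝ] Module.Dual ℝ V₀ := M.ipForm.compl₁₂ LinearMap.id V₀.subtype
  refine ⟨V₀.subtype ∘ₗ e.symm.toLinearMap ∘ₗ R, fun g => (hV₀ _).1 (e.symm (R g)).2,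
    fun g hg => ?_⟩
  refine fluxForm_eq_of_forall_mem_V M hL hg fun v hv => ?_
  have h1 := hT (e.symm (R g)) ⟨v, (hV₀ v).2 hv⟩
  rw [← he, LinearEquiv.apply_symm_apply] at h1
  exact h1.symm.trans (M.ipForm_apply g v)

/-! ### The discrete Poisson problem -/

theorem bForm_eq_bStar (P : Poisson) (Φ w : PW N) : bForm M P Φ w = bStar M P w Φ := by
  cases P with
  | ldg s => rw [bForm, bStar, fluxForm_adjoint, neg_neg]
  | rt => rw [bForm, bStar, M.ip_comm]

theorem const_mem_W (m : ℕ) (P : Poisson) (c : ℝ) : const N c ∈ W M m P := by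
  cases P with
  | ldg s => exact const_mem_U N m c
  | rt => exact ⟨const_mem_U N (m + 1) c, fun j => by simp [trace, const]⟩

theorem W_sub {m : ℕ} {P : Poisson} {u w : PW N} (hu : u ∈ W M m P) (hw : w ∈ W M m P) :
    u - w ∈ W M m P := by
  cases P with
  | ldg s => exact U_sub hu hw
  | rt =>
    refine ⟨U_sub hu.1 hw.1, fun j => ?_⟩
    have h1 := hu.2 j
    have h2 := hw.2 j
    simp only [trace, Pi.sub_apply, eval_sub] at h1 h2 ⊢
    rw [h1, h2]

theorem bStar_sub_left (P : Poisson) (E F v : PW N) :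
    bStar M P (E - F) v = bStar M P E v - bStar M P F v := by
  cases P with
  | ldg s => exact fluxForm_sub_left M _ _ _ _
  | rt => simp only [bStar, deriv_sub, M.ip_sub_left]; ring

/-- The electric field is bounded by the charge density. -/
theorem exists_field_bound (m : ℕ) {L : ℝ} (hL : 0 < L) :
    ∃ K : ℝ, 1 ≤ K ∧ ∀ {N : ℕ} [NeZero N] (M : Mesh N L) (P : Poisson) (g E : PW N),
      M.ip g (const N 1) = 0 → E ∈ W M m P → M.ip E (const N 1) = 0 →
      (∀ v ∈ V M m, -bStar M P E v = M.ip g v) →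
      ∀ j, ∀ x ∈ Set.Icc (M.left j) (M.right j), |(E j).eval x| ≤ K * M.nrm g := by
  obtain ⟨K, hK1, hK⟩ := exists_flux_sup_bound m hL
  refine ⟨max K (2 * Real.sqrt L), hK1.trans (le_max_left _ _),
    fun {N} _ M P g E hg hE hE1 hgauss j x hx => ?_⟩
  have hn := M.nrm_nonneg g
  cases P with
  | ldg s =>
    have h1 := fluxForm_eq_of_forall_mem_V M hL (m := m) (s := s.opp) (w := -E) hg fun v hv => by
      rw [fluxForm_neg_left]; exact hgauss v hv
    have hE' : -E ∈ U N m := fun j => by rw [Pi.neg_apply, natDegree_neg]; exact hE j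
    have h2 : M.ip (-E) (const N 1) = 0 := by
      rw [← M.ipForm_apply, map_neg, LinearMap.neg_apply, M.ipForm_apply, hE1, neg_zero]
    have h3 := hK M s.opp (-E) g hE' h2 h1 j x hx
    rw [Pi.neg_apply, eval_neg, abs_neg] at h3
    exact h3.trans (mul_le_mul_of_nonneg_right (le_max_left _ _) hn)
  | rt =>
    have hjump : ∀ i, jump M E i = 0 := fun i => by rw [jump, hE.2 i, sub_self]
    have hmean : M.ip (deriv E) (const N 1) = 0 := by
      have h := fluxForm_const_left M .plus E 1
      simp only [fluxForm, hjump, mul_zero, Finset.sum_const_zero, zero_add] at h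
      rw [M.ip_comm, h]
    -- Continuity of `E` on the torus makes its derivative mean-free, hence an admissible test
    -- function.
    have h1 := hgauss (deriv E) ⟨U_deriv hE.1, hmean⟩
    rw [bStar, neg_neg] at h1
    have h2 : M.nrm (deriv E) ≤ M.nrm g := by
      have h3 : M.nrm (deriv E) * M.nrm (deriv E) ≤ M.nrm g * M.nrm (deriv E) := by
        rw [← sq, M.nrm_sq, h1]
        exact (le_abs_self _).trans (M.abs_ip_le _ _)
      rcases (M.nrm_nonneg (deriv E)).eq_or_lt with h0 | h0
      · rw [← h0]; exact hn
      · exact le_of_mul_le_mul_right h3 h0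
    have h3 := abs_eval_le_of_mean_zero M hL hE1 j hx
    simp only [hjump, abs_zero, Finset.sum_const_zero, add_zero] at h3
    calc |(E j).eval x| ≤ 2 * (Real.sqrt L * M.nrm (deriv E)) := h3
      _ ≤ 2 * (Real.sqrt L * M.nrm g) := by gcongr
      _ = 2 * Real.sqrt L * M.nrm g := by ring
      _ ≤ _ := mul_le_mul_of_nonneg_right (le_max_right _ _) hn

namespace SolvesPoisson

variable {M} {m : ℕ} {P : Poisson} {ρ : ℝ} {D₁ Φ₁ E₁ D₂ Φ₂ E₂ : PW N}

/-- Constants lie in `W_h` and `b_h` annihilates them. This is the normalisation that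
`exists_field_bound` requires. -/
theorem field_mean (h : SolvesPoisson M m P ρ D₁ Φ₁ E₁) : M.ip E₁ (const N 1) = 0 := by
  rw [h.field _ (const_mem_W M m P 1)]
  cases P with
  | ldg s => rw [bForm, fluxForm_const_right]; simp
  | rt => rw [bForm, deriv_const, ← M.ipForm_apply, map_zero]; simp

/-- Taking the two solutions at different times makes `⟨E(r), E(t)⟩` affine in the density at time
`r`. -/
theorem ip_field (h₁ : SolvesPoisson M m P ρ D₁ Φ₁ E₁) (h₂ : SolvesPoisson M m P ρ D₂ Φ₂ E₂) :
    M.ip E₁ E₂ = M.ip (D₂ - const N ρ) Φ₁ := by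
  rw [h₁.field E₂ h₂.memW, bForm_eq_bStar, h₂.gauss Φ₁ h₁.memV]

end SolvesPoisson

end Forms

/-! ### Time derivatives -/

section TimeDeriv

variable {N : ℕ} {L : ℝ} (M : Mesh N L)

/-- A linear functional commutes with the time derivative. -/
theorem HasTimeDeriv.linear {m : ℕ} {I : Set ℝ} {u : ℝ → PW N} {u' : PW N} {t : ℝ}
    (h : HasTimeDeriv I u u' t) (ht : t ∈ I) (hu : ∀ r ∈ I, u r ∈ U N m) (hu' : u' ∈ U N m)
    (l : PW N →ₗ[ℝ] ℝ) : HasDerivWithinAt (fun r => l (u r)) (l u') I t := by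
  have hl : ∀ w ∈ U N m, l w = ∑ j, ∑ i ∈ Finset.range (m + 1),
      (w j).coeff i * l (Pi.single j (X ^ i)) := by
    intro w hw
    conv_lhs => rw [eq_sum_monomials hw]
    simp only [map_sum, map_smul, smul_eq_mul]
  have h1 : HasDerivWithinAt (fun r => ∑ j, ∑ i ∈ Finset.range (m + 1),
      (u r j).coeff i * l (Pi.single j (X ^ i))) (l u') I t := by
    rw [hl u' hu']
    exact HasDerivWithinAt.fun_sum fun j _ => HasDerivWithinAt.fun_sum fun i _ =>
      (h j i).mul_const _
  exact h1.congr (fun r hr => hl _ (hu r hr)) (hl _ (hu t ht))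

/-- The time derivative of a linear operator applied to a curve. -/
theorem HasTimeDeriv.map {m : ℕ} {I : Set ℝ} {u : ℝ → PW N} {u' : PW N} {t : ℝ}
    (h : HasTimeDeriv I u u' t) (ht : t ∈ I) (hu : ∀ r ∈ I, u r ∈ U N m) (hu' : u' ∈ U N m)
    (S : PW N →ₗ[ℝ] PW N) : HasTimeDeriv I (fun r => S (u r)) (S u') t := fun j i =>
  h.linear ht hu hu' ((lcoeff ℝ i) ∘ₗ (LinearMap.proj j : PW N →ₗ[ℝ] ℝ[X]) ∘ₗ S)

/-- Product rule for the `L²` inner product. -/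
theorem HasTimeDeriv.ip {m : ℕ} {I : Set ℝ} {u w : ℝ → PW N} {u' w' : PW N} {t : ℝ}
    (h : HasTimeDeriv I u u' t) (k : HasTimeDeriv I w w' t) (ht : t ∈ I)
    (hu : ∀ r ∈ I, u r ∈ U N m) (hu' : u' ∈ U N m)
    (hw : ∀ r ∈ I, w r ∈ U N m) (hw' : w' ∈ U N m) :
    HasDerivWithinAt (fun r => M.ip (u r) (w r)) (M.ip u' (w t) + M.ip (u t) w') I t := by
  have hl : ∀ v ∈ U N m, ∀ z, M.ip v z = ∑ j, ∑ i ∈ Finset.range (m + 1),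
      (v j).coeff i * M.ip (Pi.single j (X ^ i)) z := by
    intro v hv z
    conv_lhs => rw [eq_sum_monomials hv]
    simp only [← M.ipForm_apply, map_sum, map_smul, smul_eq_mul, LinearMap.sum_apply,
      LinearMap.smul_apply]
  have h1 : HasDerivWithinAt (fun r => ∑ j, ∑ i ∈ Finset.range (m + 1),
      (u r j).coeff i * M.ip (Pi.single j (X ^ i)) (w r))
      (M.ip u' (w t) + M.ip (u t) w') I t := by
    rw [hl u' hu', hl (u t) (hu t ht)]
    simp only [← Finset.sum_add_distrib]
    refine HasDerivWithinAt.fun_sum fun j _ => HasDerivWithinAt.fun_sum fun i _ => ?_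
    refine (h j i).mul ?_
    have := k.linear ht hw hw' (M.ipForm (Pi.single j (X ^ i)))
    simpa only [M.ipForm_apply] using this
  exact h1.congr (fun r hr => hl _ (hu r hr) _) (hl _ (hu t ht) _)

/-- A function dominated by one with a double zero has zero derivative. -/
theorem hasDerivWithinAt_zero_of_le {I : Set ℝ} {R q : ℝ → ℝ} {C t : ℝ} (ht : t ∈ I)
    (hR : ∀ r ∈ I, |R r| ≤ C * q r) (hq : HasDerivWithinAt q 0 I t) (hqt : q t = 0) :
    HasDerivWithinAt R 0 I t := by
  have hRt : R t = 0 := by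
    have := hR t ht
    rw [hqt, mul_zero] at this
    exact abs_nonpos_iff.1 this
  rw [hasDerivWithinAt_iff_isLittleO] at hq ⊢
  simp only [hRt, hqt, smul_zero, sub_zero] at hq ⊢
  refine Asymptotics.IsBigO.trans_isLittleO ?_ hq
  refine Asymptotics.IsBigO.of_bound |C| ?_
  filter_upwards [self_mem_nhdsWithin] with r hr
  rw [Real.norm_eq_abs, Real.norm_eq_abs, ← abs_mul]
  exact (hR r hr).trans (le_abs_self _)

/-- The time derivative of the potential energy. -/
theorem hasDerivWithinAt_ip_field [NeZero N] (hL : 0 < L) {m : ℕ} {P : Poisson} {ρ : ℝ} {I : Set ℝ}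
    {D₀ Φ E : ℝ → PW N} {D₀' : PW N} {t : ℝ} (ht : t ∈ I) (hD : ∀ r ∈ I, D₀ r ∈ U N m)
    (hD' : D₀' ∈ U N m) (h : HasTimeDeriv I D₀ D₀' t)
    (hP : ∀ r ∈ I, SolvesPoisson M m P ρ (D₀ r) (Φ r) (E r)) :
    HasDerivWithinAt (fun r => M.ip (E r) (E r)) (2 * M.ip D₀' (Φ t)) I t := by
  obtain ⟨K, hK1, hK⟩ := exists_field_bound m hL
  -- Neither `E` nor `Φ` is assumed differentiable. Polarisation splits `‖E(r)‖²` into `‖E(r) -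
  -- E(t)‖²` and a part affine in `D₀ r`; the former is dominated by `q`, which vanishes to second
  -- order at `t`.
  set q : ℝ → ℝ := fun r => M.ip (D₀ r - D₀ t) (D₀ r - D₀ t) with hq
  set R : ℝ → ℝ := fun r => M.ip (E r - E t) (E r - E t) with hRdef
  have hq' : HasDerivWithinAt q 0 I t := by
    have hd : HasTimeDeriv I (fun r => D₀ r - D₀ t) D₀' t := fun j i => by
      simpa only [Pi.sub_apply, coeff_sub] using (h j i).sub_const _
    refine (hd.ip M hd ht (fun r hr => U_sub (hD r hr) (hD t ht)) hD'
      (fun r hr => U_sub (hD r hr) (hD t ht)) hD').congr_deriv ?_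
    simp only [sub_self, ← M.ipForm_apply, map_zero, LinearMap.zero_apply, add_zero]
  have hR : ∀ r ∈ I, |R r| ≤ K ^ 2 * L * q r := by
    intro r hr
    have hg : M.ip (D₀ r - D₀ t) (const N 1) = 0 := by
      have h1 := (hP r hr).neutral
      have h2 := (hP t ht).neutral
      rw [M.ip_sub_left] at h1 h2 ⊢
      linarith
    have hb := hK M P (D₀ r - D₀ t) (E r - E t) hg (W_sub M (hP r hr).memW (hP t ht).memW)
      (by rw [M.ip_sub_left, (hP r hr).field_mean, (hP t ht).field_mean, sub_zero])
      (fun v hv => by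
        have h1 := (hP r hr).gauss v hv
        have h2 := (hP t ht).gauss v hv
        rw [M.ip_sub_left] at h1 h2
        rw [bStar_sub_left, M.ip_sub_left]
        linarith)
    have hn := M.nrm_le_of_forall_abs_le
      (mul_nonneg (zero_le_one.trans hK1) (M.nrm_nonneg _)) hb
    rw [abs_of_nonneg (M.ip_self_nonneg _)]
    simp only [hq]
    rw [← M.nrm_sq, ← M.nrm_sq]
    calc M.nrm (E r - E t) ^ 2 ≤ (K * M.nrm (D₀ r - D₀ t) * Real.sqrt L) ^ 2 :=
          pow_le_pow_left₀ (M.nrm_nonneg _) hn 2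
      _ = K ^ 2 * L * M.nrm (D₀ r - D₀ t) ^ 2 := by
          rw [mul_pow, mul_pow, Real.sq_sqrt hL.le]; ring
  have hR' : HasDerivWithinAt R 0 I t :=
    hasDerivWithinAt_zero_of_le ht hR hq' (by simp [hq, ← M.ipForm_apply])
  have hlin := h.linear ht hD hD' (M.ipForm (Φ t))
  simp only [M.ipForm_apply, M.ip_comm (Φ t)] at hlin
  have hid : ∀ r ∈ I, M.ip (E r) (E r)
      = R r + 2 * M.ip (D₀ r) (Φ t) + (M.ip (E t) (E t) - 2 * M.ip (D₀ t) (Φ t)) := by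
    intro r hr
    have h1 := (hP t ht).ip_field (hP r hr)
    have h2 := (hP t ht).ip_field (hP t ht)
    have h3 := M.ip_comm (E r) (E t)
    simp only [M.ip_sub_left] at h1 h2
    simp only [hRdef, M.ip_sub_left, M.ip_sub_right]
    linarith
  refine (((hR'.add (hlin.const_mul 2)).add_const _).congr hid (hid t ht)).congr_deriv ?_
  ring

end TimeDeriv

/-! ### The scheme in terms of the perturbation -/

section Scheme

variable {N : ℕ} [NeZero N] {L : ℝ} {M : Mesh N L} {m NH : ℕ} {s : Side} {P : Poisson}
  {T₀ τ₀ ρ : ℝ} {I : Set ℝ} {D : ℕ → ℝ → PW N} {Φ E : ℝ → PW N}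

theorem aStar_const_right (M : Mesh N L) (T₀ : ℝ) (s : Side) (u : PW N) (c : ℝ) :
    aStar M T₀ s u (const N c) = 0 := by
  rw [aStar, fluxForm_const_right, mul_zero]

theorem aStar_sub_right (M : Mesh N L) (T₀ : ℝ) (s : Side) (u v w : PW N) :
    aStar M T₀ s u (v - w) = aStar M T₀ s u v - aStar M T₀ s u w := by
  simp only [aStar, ← fluxB_apply, map_sub]; ring

theorem IsSolution.pert_mem (h : IsSolution M m NH s P T₀ τ₀ ρ I D Φ E) {t : ℝ} (ht : t ∈ I)
    {k : ℕ} (hk : k ≤ NH + 1) : pert ρ D k t ∈ U N m := by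
  rcases Nat.lt_or_ge NH k with h1 | h1
  · obtain rfl : k = NH + 1 := by omega
    rw [pert, h.closure t ht]
    exact fun j => by simp
  cases k with
  | zero => exact U_sub (h.mem t ht 0 h1) (const_mem_U N m ρ)
  | succ k => exact h.mem t ht (k + 1) h1

/-- One formula covers all modes: at `k = 0` the truncated index `k - 1` is harmless because its
terms carry the factor `√0`, and at `k = 1` the background drops out of the transport term because
constants are annihilated. -/
theorem IsSolution.modes (h : IsSolution M m NH s P T₀ τ₀ ρ I D Φ E) {t : ℝ} (ht : t ∈ I)
    {k : ℕ} (hk : k ≤ NH) :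
    ∃ x' ∈ U N m, HasTimeDeriv I (pert ρ D k) x' t ∧ ∀ u ∈ U N m,
      M.ip x' u = -(Real.sqrt k * aStar M T₀ s u (pert ρ D (k - 1) t))
        + Real.sqrt (k + 1) * aStar M T₀ s (pert ρ D (k + 1) t) u
        - (if k = 1 then ρ / T₀ * aStar M T₀ s u (Φ t) else 0)
        + Real.sqrt (k / T₀) * M.ip (E t * pert ρ D (k - 1) t) u
        - k / τ₀ * M.ip (pert ρ D k t) u := by
  match k, hk with
  | 0, _ =>
    obtain ⟨x', hx', hd, heq⟩ := h.mode_zero t ht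
    refine ⟨x', hx', fun j i => ?_, fun u hu => ?_⟩
    · simpa only [pert, Pi.sub_apply, coeff_sub] using (hd j i).sub_const _
    · have := heq u hu
      simp [pert]
      linarith
  | 1, _ =>
    obtain ⟨x', hx', hd, heq⟩ := h.mode_one t ht
    refine ⟨x', hx', hd, fun u hu => ?_⟩
    have := heq u hu
    rw [aForm_eq_aStar, aForm_eq_aStar] at this
    have h2 : ((1 : ℕ) : ℝ) + 1 = 2 := by norm_num
    rw [h2, if_pos rfl]
    simp only [pert, Nat.sub_self, aStar_sub_right, aStar_const_right, Nat.cast_one,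
      Real.sqrt_one]
    linarith
  | k + 2, hk =>
    obtain ⟨x', hx', hd, heq⟩ := h.mode_ge_two t ht (k + 2) (by omega) hk
    refine ⟨x', hx', hd, fun u hu => ?_⟩
    have := heq u hu
    rw [aForm_eq_aStar] at this
    have hp : pert ρ D (k + 2 - 1) t = D (k + 2 - 1) t := rfl
    rw [if_neg (by omega), hp]
    simp only [pert]
    linarith

/-- The energy of the perturbation multiplied by the background density. -/
def scaledEnergy (M : Mesh N L) (T₀ ρ : ℝ) (NH : ℕ) (D : ℕ → ℝ → PW N) (E : ℝ → PW N)
    (t : ℝ) : ℝ :=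
  1 / 2 * ∑ k ∈ Finset.range (NH + 1), M.ip (pert ρ D k t) (pert ρ D k t)
    + ρ / (2 * T₀) * M.ip (E t) (E t)

/-- Energy balance: the transport terms and the linear field terms cancel. -/
theorem IsSolution.energy_balance (hL : 0 < L)
    (h : IsSolution M m NH s P T₀ τ₀ ρ I D Φ E) (hNH : 1 ≤ NH) {t : ℝ} (ht : t ∈ I) :
    HasDerivWithinAt (scaledEnergy M T₀ ρ NH D E)
      (∑ k ∈ Finset.range (NH + 1), Real.sqrt (k / T₀)
          * M.ip (E t * pert ρ D (k - 1) t) (pert ρ D k t)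
        - 1 / τ₀ * ∑ k ∈ Finset.range (NH + 1),
          k * M.ip (pert ρ D k t) (pert ρ D k t)) I t := by
  have hex : ∀ k, ∃ x' : PW N, k ≤ NH → x' ∈ U N m ∧ HasTimeDeriv I (pert ρ D k) x' t ∧
      ∀ u ∈ U N m,
      M.ip x' u = -(Real.sqrt k * aStar M T₀ s u (pert ρ D (k - 1) t))
        + Real.sqrt (k + 1) * aStar M T₀ s (pert ρ D (k + 1) t) u
        - (if k = 1 then ρ / T₀ * aStar M T₀ s u (Φ t) else 0)
        + Real.sqrt (k / T₀) * M.ip (E t * pert ρ D (k - 1) t) u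
        - k / τ₀ * M.ip (pert ρ D k t) u := by
    intro k
    by_cases hk : k ≤ NH
    · obtain ⟨x', h1, h2, h3⟩ := h.modes ht hk
      exact ⟨x', fun _ => ⟨h1, h2, h3⟩⟩
    · exact ⟨0, fun hk' => absurd hk' hk⟩
  choose x' hx' using hex
  have hkin : HasDerivWithinAt
      (fun r => ∑ k ∈ Finset.range (NH + 1), M.ip (pert ρ D k r) (pert ρ D k r))
      (∑ k ∈ Finset.range (NH + 1), 2 * M.ip (x' k) (pert ρ D k t)) I t := by
    refine HasDerivWithinAt.fun_sum fun k hk => ?_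
    have hk' : k ≤ NH := by
      rw [Finset.mem_range] at hk; omega
    obtain ⟨h1, h2, _⟩ := hx' k hk'
    refine (h2.ip M h2 ht (fun r hr => h.pert_mem hr (by omega)) h1
      (fun r hr => h.pert_mem hr (by omega)) h1).congr_deriv ?_
    rw [M.ip_comm (pert ρ D k t)]
    ring
  obtain ⟨D₀', hD₀', hd₀, heq₀⟩ := h.mode_zero t ht
  have hfield := hasDerivWithinAt_ip_field M hL ht (fun r hr => h.mem r hr 0 (Nat.zero_le _))
    hD₀' hd₀ h.poisson
  refine ((hkin.const_mul (1 / 2)).add (hfield.const_mul (ρ / (2 * T₀)))).congr_deriv ?_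
  -- The density equation tested with the potential: this is what cancels the linear field term of
  -- mode one.
  have hΦ : M.ip D₀' (Φ t) = aStar M T₀ s (D 1 t) (Φ t) := by
    have := heq₀ (Φ t) (h.poisson t ht).memV.1
    linarith
  -- The flux between neighbouring modes. It vanishes at `0` by the factor `√0` and at `NH + 1` by
  -- the closure.
  set A : ℕ → ℝ := fun k => Real.sqrt k * aStar M T₀ s (pert ρ D k t) (pert ρ D (k - 1) t)
    with hA
  have hterm : ∀ k ∈ Finset.range (NH + 1), M.ip (x' k) (pert ρ D k t)
      = (A (k + 1) - A k)
        - (if k = 1 then ρ / T₀ * aStar M T₀ s (pert ρ D k t) (Φ t) else 0)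
        + Real.sqrt (k / T₀) * M.ip (E t * pert ρ D (k - 1) t) (pert ρ D k t)
        - 1 / τ₀ * (k * M.ip (pert ρ D k t) (pert ρ D k t)) := by
    intro k hk
    have hk' : k ≤ NH := by
      rw [Finset.mem_range] at hk; omega
    rw [(hx' k hk').2.2 _ (h.pert_mem ht (by omega))]
    simp only [hA, Nat.add_sub_cancel, Nat.cast_add, Nat.cast_one]
    ring
  have hA0 : A 0 = 0 := by simp [hA]
  have hA1 : A (NH + 1) = 0 := by
    have hz : pert ρ D (NH + 1) t = 0 := h.closure t ht
    simp only [hA, hz, aStar, ← fluxB_apply, map_zero, LinearMap.zero_apply, mul_zero]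
  rw [← Finset.mul_sum, Finset.sum_congr rfl hterm]
  simp only [Finset.sum_add_distrib, Finset.sum_sub_distrib, ← Finset.mul_sum]
  have htel := Finset.sum_range_sub A (NH + 1)
  rw [Finset.sum_sub_distrib] at htel
  rw [Finset.sum_ite_eq' (Finset.range (NH + 1)) 1,
    if_pos (Finset.mem_range.2 (by omega)), htel, hA0, hA1, hΦ]
  simp only [pert]
  ring

/-- Evolution of the correction `⟨D_{h,1}, w⟩`, where `w` is the discrete primitive of
`D_{h,0} - ρ_∞`. -/
theorem IsSolution.correction_balance (hL : 0 < L) (hT₀ : 0 < T₀)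
    (h : IsSolution M m NH s P T₀ τ₀ ρ I D Φ E) (hNH : 1 ≤ NH) {S : PW N →ₗ[ℝ] PW N}
    (hSV : ∀ g, S g ∈ V M m)
    (hS : ∀ g, M.ip g (const N 1) = 0 → ∀ v ∈ U N m, aStar M T₀ s (S g) v = M.ip g v)
    {t : ℝ} (ht : t ∈ I) :
    ∃ z, 0 ≤ z ∧ z ≤ M.ip (D 1 t) (D 1 t) ∧
    HasDerivWithinAt (fun r => M.ip (D 1 r) (S (pert ρ D 0 r)))
      (-M.ip (pert ρ D 0 t) (pert ρ D 0 t) - ρ / T₀ * M.ip (E t) (E t)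
        + Real.sqrt 2 * aStar M T₀ s (D 2 t) (S (pert ρ D 0 t))
        + Real.sqrt (1 / T₀) * M.ip (E t * pert ρ D 0 t) (S (pert ρ D 0 t))
        - 1 / τ₀ * M.ip (D 1 t) (S (pert ρ D 0 t)) + z) I t := by
  obtain ⟨x₀', hx₀', hd₀, heq₀⟩ := h.modes ht (Nat.zero_le NH)
  obtain ⟨x₁', hx₁', hd₁, heq₁⟩ := h.modes ht hNH
  have hD1 : D 1 t ∈ U N m := h.mem t ht 1 hNH
  have hx₀eq : ∀ u ∈ U N m, M.ip x₀' u = aStar M T₀ s (D 1 t) u := fun u hu => by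
    rw [heq₀ u hu]; simp [pert]
  have hx₀mean : M.ip x₀' (const N 1) = 0 := by
    rw [hx₀eq _ (const_mem_U N m 1), aStar_const_right]
  obtain ⟨y, hy, c, hyc⟩ := exists_mean_decomposition M hL hD1
  -- The density equation says that `x₀'` is the discrete derivative of `D 1 t`. The primitive thus
  -- returns `D 1 t` without its mean, and `⟨D_1, ∂_t w⟩` becomes `‖y‖²`, with no inverse power of
  -- the mesh size.
  have hSx : S x₀' = y := by
    have hflux : ∀ v ∈ U N m, fluxForm M s.opp (S x₀' - y) v = 0 := by
      intro v hv
      have h1 := hS x₀' hx₀mean v hv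
      rw [hx₀eq v hv] at h1
      have h2 := mul_left_cancel₀ (Real.sqrt_pos.2 hT₀).ne' h1
      have h3 : fluxForm M s.opp (D 1 t) v = fluxForm M s.opp y v := by
        rw [hyc]
        simp only [← fluxB_apply, map_add, LinearMap.add_apply]
        rw [fluxB_apply M s.opp (const N c), fluxForm_const_left, add_zero]
      rw [fluxForm_sub_left, h2, h3, sub_self]
    have hV : S x₀' - y ∈ V M m := ⟨U_sub (hSV _).1 hy.1, by
      rw [M.ip_sub_left, (hSV _).2, hy.2, sub_zero]⟩
    exact sub_eq_zero.1 (eq_zero_of_fluxForm_eq_zero M hL hV hflux)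
  have hyy : M.ip (D 1 t) y = M.ip y y := by
    rw [hyc, M.ip_add_left, M.ip_comm (const N c), M.ip_const_right, hy.2, mul_zero, add_zero]
  have hDD : M.ip (D 1 t) (D 1 t) = M.ip y y + c ^ 2 * L := by
    rw [hyc, M.ip_add_left, M.ip_add_right, M.ip_add_right, M.ip_const_const,
      M.ip_comm (const N c), M.ip_const_right y c, hy.2]
    ring
  refine ⟨M.ip y y, M.ip_self_nonneg y, ?_, ?_⟩
  · rw [hDD]
    have : 0 ≤ c ^ 2 * L := by positivity
    linarith
  have hS' := hd₀.map ht (fun r hr => h.pert_mem hr (Nat.zero_le _)) hx₀' S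
  have hder := HasTimeDeriv.ip M (u := D 1) hd₁ hS' ht (fun r hr => h.mem r hr 1 hNH) hx₁'
    (fun r _ => (hSV _).1) (hSV _).1
  refine hder.congr_deriv ?_
  have hneutral : M.ip (pert ρ D 0 t) (const N 1) = 0 := (h.poisson t ht).neutral
  have hΦ : M.ip (pert ρ D 0 t) (Φ t) = M.ip (E t) (E t) :=
    ((h.poisson t ht).ip_field (h.poisson t ht)).symm
  rw [hSx, hyy, heq₁ _ (hSV _).1, if_pos rfl, Nat.sub_self,
    hS _ hneutral _ (h.pert_mem ht (Nat.zero_le _)), hS _ hneutral _ (h.poisson t ht).memV.1, hΦ]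
  have h2 : ((1 : ℕ) : ℝ) + 1 = 2 := by norm_num
  rw [h2]
  simp only [pert, Nat.cast_one, Real.sqrt_one]
  ring

end Scheme

/-! ### Uniform constants -/

theorem Mesh.nrm_smul {N : ℕ} {L : ℝ} (M : Mesh N L) {c : ℝ} (hc : 0 ≤ c) (u : PW N) :
    M.nrm (c • u) = c * M.nrm u := by
  rw [Mesh.nrm, Mesh.nrm, M.ip_smul_left, M.ip_smul_right, ← mul_assoc,
    Real.sqrt_mul (mul_self_nonneg c), Real.sqrt_mul_self hc]

/-- The decay argument uses the discretisation quantitatively only through this single `K`: the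
force bound, the norm of the primitive, and the coupling of the primitive with another mode. -/
theorem exists_uniform_constant {T₀ L Cqu : ℝ} (hT₀ : 0 < T₀) (hL : 0 < L) (hCqu : 0 < Cqu)
    (m : ℕ) :
    ∃ K : ℝ, 1 ≤ K ∧ ∀ {N : ℕ} [NeZero N] (M : Mesh N L), M.QuasiUniform Cqu →
      (∀ (P : Poisson) (ρ : ℝ) (D₀ Φ E f u : PW N), SolvesPoisson M m P ρ D₀ Φ E →
        Real.sqrt (1 / T₀) * |M.ip (E * f) u|
          ≤ K * M.nrm (D₀ - const N ρ) * M.nrm f * M.nrm u) ∧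
      ∀ (s : Side) (g w : PW N), w ∈ V M m →
        (∀ v ∈ U N m, aStar M T₀ s w v = M.ip g v) →
        M.nrm w ≤ K * M.nrm g ∧ ∀ v ∈ U N m, |aStar M T₀ s v w| ≤ K * (M.nrm v * M.nrm g) := by
  obtain ⟨K₁, h₁, hfield⟩ := exists_field_bound m hL
  obtain ⟨K₂, h₂, hsup⟩ := exists_flux_sup_bound m hL
  obtain ⟨K₃, h₃, hopp⟩ := exists_flux_opp_bound m Cqu hCqu
  have hs : 0 < Real.sqrt T₀ := Real.sqrt_pos.2 hT₀
  set i := (Real.sqrt T₀)⁻¹ with hi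
  have hi0 : 0 < i := inv_pos.2 hs
  set K := max (Real.sqrt (1 / T₀) * K₁) (max (K₂ * i * Real.sqrt L) K₃) with hK
  have hKa : Real.sqrt (1 / T₀) * K₁ ≤ K := le_max_left _ _
  have hKb : K₂ * i * Real.sqrt L ≤ K := (le_max_left _ _).trans (le_max_right _ _)
  have hKc : K₃ ≤ K := (le_max_right _ _).trans (le_max_right _ _)
  refine ⟨K, h₃.trans hKc, fun {N} _ M hqu => ⟨?_, ?_⟩⟩
  · intro P ρ D₀ Φ E f u hP
    have hb := hfield M P (D₀ - const N ρ) E hP.neutral hP.memW hP.field_mean hP.gauss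
    have h0 := M.nrm_nonneg (D₀ - const N ρ)
    have h1 := M.nrm_nonneg f
    have h2 := M.nrm_nonneg u
    have hle := M.abs_ip_mul_le (u := f) (w := u) (mul_nonneg (zero_le_one.trans h₁) h0) hb
    calc Real.sqrt (1 / T₀) * |M.ip (E * f) u|
        ≤ Real.sqrt (1 / T₀) * (K₁ * M.nrm (D₀ - const N ρ) * M.nrm f * M.nrm u) := by gcongr
      _ = Real.sqrt (1 / T₀) * K₁ * M.nrm (D₀ - const N ρ) * M.nrm f * M.nrm u := by ring
      _ ≤ _ := by gcongr
  · intro s g w hw hg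
    have hg' : ∀ v ∈ U N m, fluxForm M s.opp w v = M.ip (i • g) v := fun v hv => by
      rw [M.ip_smul_left, ← hg v hv, aStar, hi, inv_mul_cancel_left₀ hs.ne']
    have hng : M.nrm (i • g) = i * M.nrm g := M.nrm_smul hi0.le g
    have h0 := M.nrm_nonneg g
    refine ⟨?_, fun v hv => ?_⟩
    · have := M.nrm_le_of_forall_abs_le
        (mul_nonneg (zero_le_one.trans h₂) (M.nrm_nonneg (i • g)))
        (hsup M s.opp w (i • g) hw.1 hw.2 hg')
      rw [hng] at this
      calc M.nrm w ≤ K₂ * (i * M.nrm g) * Real.sqrt L := this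
        _ = K₂ * i * Real.sqrt L * M.nrm g := by ring
        _ ≤ _ := by gcongr
    · have := hopp M hqu s.opp w (i • g) v hw.1 hv hg'
      rw [hng] at this
      rw [aStar, abs_mul, abs_of_pos hs]
      have hv0 := M.nrm_nonneg v
      calc Real.sqrt T₀ * |fluxForm M s.opp v w|
          ≤ Real.sqrt T₀ * (K₃ * (M.nrm v * (i * M.nrm g))) := by gcongr
        _ = K₃ * (M.nrm v * M.nrm g) := by rw [hi]; field_simp
        _ ≤ _ := by gcongr

/-! ### The differential inequality -/

/-- Absorption of the cross terms by the dissipation. -/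
theorem dissipation_absorbs {K τ n₀ x q : ℝ} (hK : 1 ≤ K) (hτ : 0 < τ) (hn₀ : 0 ≤ n₀)
    (hq : 0 ≤ q) (hx : x ≤ min τ τ⁻¹ / (40 * K ^ 2)) :
    -(τ⁻¹ * q ^ 2) + K * n₀ * x * q
        + min τ τ⁻¹ / (100 * K ^ 2) * (-n₀ ^ 2 + 2 * K * q * n₀ + τ⁻¹ * K * q * n₀
          + K ^ 2 * n₀ ^ 2 * x + q ^ 2)
      ≤ -(min τ τ⁻¹ / (100 * K ^ 2) / 2 * (n₀ ^ 2 + q ^ 2)) := by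
  set i := τ⁻¹ with hi
  set μ := min τ i with hμ
  have hi0 : 0 < i := inv_pos.2 hτ
  have hμ0 : 0 < μ := lt_min hτ hi0
  have hμi : μ ≤ i := min_le_right _ _
  have hτi : τ * i = 1 := mul_inv_cancel₀ hτ.ne'
  have hμi1 : μ * i ≤ 1 := hτi ▸ mul_le_mul_of_nonneg_right (min_le_left _ _) hi0.le
  have hμ1 : μ ≤ 1 := by nlinarith
  -- This fixes the scaling of `α`: the cross terms cost `α K² (2 + τ⁻¹)² q²`, and the damping
  -- offers only `τ⁻¹ q²`. Expanding the square uses `μ ≤ i`, `μ ≤ 1` and `μ i ≤ 1`.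
  have hμi2 : μ * (2 + i) ^ 2 ≤ 9 * i := by nlinarith
  set α := μ / (100 * K ^ 2) with hα
  have hK0 : 0 < K := zero_lt_one.trans_le hK
  have hα0 : 0 < α := by positivity
  have hαK : α * K ^ 2 = μ / 100 := by rw [hα]; field_simp
  have hK2 : 1 ≤ K ^ 2 := one_le_pow₀ hK
  have hαi : α ≤ i / 100 := by nlinarith
  have hxα : K * x ≤ 5 / 2 * α * K := by
    have : μ / (40 * K ^ 2) = 5 / 2 * α := by rw [hα]; field_simp; norm_num
    rw [this] at hx
    nlinarith
  have hxK : K ^ 2 * x ≤ 1 / 40 := by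
    calc K ^ 2 * x ≤ K ^ 2 * (μ / (40 * K ^ 2)) := by gcongr
      _ = μ / 40 := by field_simp
      _ ≤ 1 / 40 := by gcongr
  have hq2 : 0 ≤ q ^ 2 := sq_nonneg q
  have hn2 : 0 ≤ n₀ ^ 2 := sq_nonneg n₀
  have e1 : α * q ^ 2 ≤ i / 100 * q ^ 2 := by gcongr
  have e2 : α * (2 * K * q * n₀ + i * K * q * n₀) ≤ α * (n₀ ^ 2 / 8) + 18 / 100 * i * q ^ 2 := by
    have h1 : 2 * K * q * n₀ + i * K * q * n₀ ≤ n₀ ^ 2 / 8 + 2 * (K * (2 + i) * q) ^ 2 := by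
      nlinarith [sq_nonneg (n₀ / 4 - K * (2 + i) * q)]
    have h2 : α * (2 * (K * (2 + i) * q) ^ 2) ≤ 18 / 100 * i * q ^ 2 := by
      calc α * (2 * (K * (2 + i) * q) ^ 2)
          = 2 * (α * K ^ 2) * (2 + i) ^ 2 * q ^ 2 := by ring
        _ = 2 / 100 * (μ * (2 + i) ^ 2) * q ^ 2 := by rw [hαK]; ring
        _ ≤ 2 / 100 * (9 * i) * q ^ 2 := by gcongr
        _ = _ := by ring
    calc _ ≤ α * (n₀ ^ 2 / 8 + 2 * (K * (2 + i) * q) ^ 2) := by gcongr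
      _ ≤ _ := by rw [mul_add]; linarith
  have e3 : K * n₀ * x * q ≤ α * (n₀ ^ 2 / 8) + i / 8 * q ^ 2 := by
    have h1 : 5 / 2 * K * q * n₀ ≤ n₀ ^ 2 / 8 + 2 * (5 / 2 * K * q) ^ 2 := by
      nlinarith [sq_nonneg (n₀ / 4 - 5 / 2 * K * q)]
    calc K * n₀ * x * q = (K * x) * (n₀ * q) := by ring
      _ ≤ (5 / 2 * α * K) * (n₀ * q) := by gcongr
      _ = α * (5 / 2 * K * q * n₀) := by ring
      _ ≤ α * (n₀ ^ 2 / 8 + 2 * (5 / 2 * K * q) ^ 2) := by gcongr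
      _ = α * (n₀ ^ 2 / 8) + 25 / 2 * (α * K ^ 2) * q ^ 2 := by ring
      _ = α * (n₀ ^ 2 / 8) + μ / 8 * q ^ 2 := by rw [hαK]; ring
      _ ≤ _ := by gcongr
  have e4 : α * (K ^ 2 * n₀ ^ 2 * x) ≤ α * (n₀ ^ 2 / 40) := by
    calc α * (K ^ 2 * n₀ ^ 2 * x) = α * (n₀ ^ 2 * (K ^ 2 * x)) := by ring
      _ ≤ α * (n₀ ^ 2 * (1 / 40)) := by gcongr
      _ = _ := by ring
  have e5 : 0 ≤ α * n₀ ^ 2 := by positivity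
  have e6 : 0 ≤ i * q ^ 2 := by positivity
  linarith

/-- A differential inequality that holds only as long as the solution is small propagates the
smallness and yields exponential decay. -/
theorem exponential_decay {I : Set ℝ} (hI : I.OrdConnected) (h0 : 0 ∈ I) (hI0 : I ⊆ Set.Ici 0)
    {F Y : ℝ → ℝ} {α δ : ℝ} (hα : 0 < α) (hδ : 0 < δ) (hY : ∀ t ∈ I, 0 ≤ Y t)
    (hlow : ∀ t ∈ I, 99 / 100 * Y t ≤ F t) (hup : ∀ t ∈ I, F t ≤ 101 / 100 * Y t)
    (hder : ∀ t ∈ I, ∃ F', HasDerivWithinAt F F' I t ∧ (Y t ≤ 2 * δ → F' ≤ -(α * Y t)))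
    (hY0 : Y 0 ≤ δ) {t : ℝ} (ht : t ∈ I) :
    Y t ≤ 3 * Y 0 * Real.exp (-(α / 2 * t)) := by
  have ht0 : 0 ≤ t := hI0 ht
  have hsub : Set.Icc 0 t ⊆ I := hI.out h0 ht
  choose! F' hF' using hder
  -- Where `F` touches the barrier `b e^{-αr/2}`, one has `Y ≤ (101/99) δ < 2δ`. The differential
  -- inequality then applies and `F' ≤ -(100/101) α F`, which is strictly below the slope of the
  -- barrier.
  have key : ∀ b, 0 < b → 101 / 100 * Y 0 ≤ b → b ≤ 101 / 100 * δ →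
      F t ≤ b * Real.exp (-(α / 2 * t)) := by
    intro b hb hb0 hbδ
    refine image_le_of_deriv_right_lt_deriv_boundary (f := F) (f' := F') (a := 0) (b := t)
      (B := fun r => b * Real.exp (-(α / 2 * r)))
      (B' := fun r => b * (Real.exp (-(α / 2 * r)) * (-(α / 2 * 1))))
      ?_ ?_ ?_ ?_ ?_ (Set.right_mem_Icc.2 ht0)
    · exact fun r hr => ((hF' r (hsub hr)).1.continuousWithinAt).mono hsub
    · intro r hr
      have h1 := (hF' r (hsub ⟨hr.1, hr.2.le⟩)).1
      refine h1.mono_of_mem_nhdsWithin (Filter.mem_of_superset (Icc_mem_nhdsGE hr.2) ?_)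
      exact (Set.Icc_subset_Icc_left hr.1).trans hsub
    · simpa using (hup 0 h0).trans hb0
    · intro r
      exact ((((hasDerivAt_id r).const_mul (α / 2)).neg).exp).const_mul b
    · intro r hr hFB
      have hrI := hsub ⟨hr.1, hr.2.le⟩
      have hexp : Real.exp (-(α / 2 * r)) ≤ 1 := by
        rw [Real.exp_le_one_iff]
        have := mul_nonneg hα.le hr.1
        linarith
      have hpos := Real.exp_pos (-(α / 2 * r))
      set ex := Real.exp (-(α / 2 * r)) with hex
      have hBpos : 0 < b * ex := mul_pos hb hpos
      have h1 := hlow r hrI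
      have h2 := hup r hrI
      have h3 : b * ex ≤ b := mul_le_of_le_one_right hb.le hexp
      rw [hFB] at h1 h2
      have h4 := (hF' r hrI).2 (by linarith)
      have h5 : α * (b * ex) ≤ α * (101 / 100 * Y r) := mul_le_mul_of_nonneg_left h2 hα.le
      have h6 : 0 < α * (b * ex) := mul_pos hα hBpos
      linarith
  have hexp := Real.exp_pos (-(α / 2 * t))
  -- A barrier must be positive, so for `Y 0 = 0` arbitrarily small values of `b` are used.
  rcases (hY 0 h0).eq_or_lt with hz | hz
  · have hle : F t ≤ 0 := by
      by_contra! hpos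
      have hb : 0 < min (101 / 100 * δ) (F t / 2 / Real.exp (-(α / 2 * t))) :=
        lt_min (by positivity) (by positivity)
      have h1 := key _ hb (by rw [← hz, mul_zero]; exact hb.le) (min_le_left _ _)
      have h2 : min (101 / 100 * δ) (F t / 2 / Real.exp (-(α / 2 * t)))
          * Real.exp (-(α / 2 * t)) ≤ F t / 2 := by
        rw [← le_div_iff₀ hexp]; exact min_le_right _ _
      linarith
    rw [← hz, mul_zero, zero_mul]
    linarith [hlow t ht]
  · have h1 := key (101 / 100 * Y 0) (by positivity) le_rfl (by linarith)
    have h2 := hlow t ht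
    have h3 : 0 < Y 0 * Real.exp (-(α / 2 * t)) := mul_pos hz hexp
    linarith

/-- The quadratic force terms are controlled by the energy and the dissipation. -/
theorem sum_force_le {N NH : ℕ} {L T₀ K n₀ : ℝ} {M : Mesh N L} (x : ℕ → PW N) (F : PW N) (hKn : 0 ≤ K * n₀)
    (hforce : ∀ f u : PW N, Real.sqrt (1 / T₀) * |M.ip (F * f) u| ≤ K * n₀ * M.nrm f * M.nrm u) :
    ∑ k ∈ Finset.range (NH + 1), Real.sqrt (k / T₀) * M.ip (F * x (k - 1)) (x k)
      ≤ K * n₀ * Real.sqrt (∑ k ∈ Finset.range (NH + 1), M.ip (x k) (x k))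
        * Real.sqrt (∑ k ∈ Finset.range (NH + 1), k * M.ip (x k) (x k)) := by
  rw [Finset.sum_range_succ']
  simp only [Nat.cast_zero, zero_div, Real.sqrt_zero, zero_mul, add_zero, Nat.add_sub_cancel]
  -- The factor `√(k + 1)` is given to the higher mode, where the damping carries the weight `k +
  -- 1`; the bound is then independent of `NH`.
  have hterm : ∀ k ∈ Finset.range NH, Real.sqrt ((k + 1 : ℕ) / T₀) * M.ip (F * x k) (x (k + 1))
      ≤ K * n₀ * (M.nrm (x k) * (Real.sqrt ((k + 1 : ℕ)) * M.nrm (x (k + 1)))) := by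
    intro k _
    have hk : Real.sqrt ((k + 1 : ℕ) / T₀) = Real.sqrt ((k + 1 : ℕ)) * Real.sqrt (1 / T₀) := by
      rw [← Real.sqrt_mul (Nat.cast_nonneg _), mul_one_div]
    calc Real.sqrt ((k + 1 : ℕ) / T₀) * M.ip (F * x k) (x (k + 1))
        = Real.sqrt ((k + 1 : ℕ)) * (Real.sqrt (1 / T₀) * M.ip (F * x k) (x (k + 1))) := by
          rw [hk]; ring
      _ ≤ Real.sqrt ((k + 1 : ℕ)) * (K * n₀ * M.nrm (x k) * M.nrm (x (k + 1))) := by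
          refine mul_le_mul_of_nonneg_left ?_ (Real.sqrt_nonneg _)
          exact (mul_le_mul_of_nonneg_left (le_abs_self _) (Real.sqrt_nonneg _)).trans
            (hforce _ _)
      _ = _ := by ring
  refine (Finset.sum_le_sum hterm).trans ?_
  rw [← Finset.mul_sum, mul_assoc (K * n₀)]
  refine mul_le_mul_of_nonneg_left ?_ hKn
  refine (Real.sum_mul_le_sqrt_mul_sqrt _ _ _).trans ?_
  gcongr
  · simp only [M.nrm_sq]
    exact Finset.sum_le_sum_of_subset_of_nonneg (Finset.range_mono (Nat.le_succ _))
      fun k _ _ => M.ip_self_nonneg _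
  · rw [Finset.sum_range_succ']
    simp only [Nat.cast_zero, zero_mul, add_zero, mul_pow, M.nrm_sq,
      Real.sq_sqrt (Nat.cast_nonneg _)]
    exact le_rfl

/-! ### Assembly of the modified energy and conclusion -/

section Main

variable {N : ℕ} [NeZero N] {L : ℝ} {M : Mesh N L} {m NH : ℕ} {s : Side} {P : Poisson}
  {T₀ τ₀ ρ : ℝ} {I : Set ℝ} {D : ℕ → ℝ → PW N} {Φ E : ℝ → PW N}

/-- Exponential decay of the scaled energy, with explicit constants. -/
theorem IsSolution.scaledEnergy_le {K : ℝ} (hL : 0 < L) (hT₀ : 0 < T₀) (hτ₀ : 0 < τ₀)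
    (hρ : 0 < ρ) (hK : 1 ≤ K) (hNH : 1 ≤ NH)
    (hforce : ∀ (D₀ Φ E f u : PW N), SolvesPoisson M m P ρ D₀ Φ E →
      Real.sqrt (1 / T₀) * |M.ip (E * f) u| ≤ K * M.nrm (D₀ - const N ρ) * M.nrm f * M.nrm u)
    (hprim : ∀ g w : PW N, w ∈ V M m → (∀ v ∈ U N m, aStar M T₀ s w v = M.ip g v) →
      M.nrm w ≤ K * M.nrm g ∧ ∀ v ∈ U N m, |aStar M T₀ s v w| ≤ K * (M.nrm v * M.nrm g))
    (hI : I.OrdConnected) (h0 : 0 ∈ I) (hI0 : I ⊆ Set.Ici 0)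
    (h : IsSolution M m NH s P T₀ τ₀ ρ I D Φ E)
    (hsmall : scaledEnergy M T₀ ρ NH D E 0 ≤ (min τ₀ τ₀⁻¹ / (200 * K ^ 2)) ^ 2)
    {t : ℝ} (ht : t ∈ I) :
    scaledEnergy M T₀ ρ NH D E t ≤ 3 * scaledEnergy M T₀ ρ NH D E 0
      * Real.exp (-(min τ₀ τ₀⁻¹ / (100 * K ^ 2) / 2 * t)) := by
  have hK0 : 0 < K := zero_lt_one.trans_le hK
  set μ := min τ₀ τ₀⁻¹ with hμ
  have hμ0 : 0 < μ := lt_min hτ₀ (inv_pos.2 hτ₀)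
  have hμ1 : μ ≤ 1 := by
    rcases le_total τ₀ 1 with h1 | h1
    · exact (min_le_left _ _).trans h1
    · exact (min_le_right _ _).trans (inv_le_one_of_one_le₀ h1)
  set α := μ / (100 * K ^ 2) with hα
  have hα0 : 0 < α := by positivity
  have hαK : α * K ≤ 1 / 100 := by
    have h1 : α * K = μ / (100 * K) := by rw [hα]; field_simp
    rw [h1, div_le_div_iff₀ (by positivity) (by norm_num)]
    linarith
  obtain ⟨S₁, hS₁V, hS₁⟩ := exists_discrete_primitive M hL m s.opp
  have hs : 0 < Real.sqrt T₀ := Real.sqrt_pos.2 hT₀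
  obtain ⟨S, hSV, hS⟩ : ∃ S : PW N →ₗ[ℝ] PW N, (∀ g, S g ∈ V M m) ∧
      ∀ g, M.ip g (const N 1) = 0 → ∀ v ∈ U N m, aStar M T₀ s (S g) v = M.ip g v := by
    refine ⟨(Real.sqrt T₀)⁻¹ • S₁, fun g => ⟨U_smul _ (hS₁V g).1, ?_⟩, fun g hg v hv => ?_⟩
    · rw [LinearMap.smul_apply, M.ip_smul_left, (hS₁V g).2, mul_zero]
    · rw [aStar, LinearMap.smul_apply, ← hS₁ g hg v hv]
      simp only [← fluxB_apply, map_smul, LinearMap.smul_apply, smul_eq_mul]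
      rw [mul_inv_cancel_left₀ hs.ne']
  set w : ℝ → PW N := fun r => S (pert ρ D 0 r) with hw
  set Y := scaledEnergy M T₀ ρ NH D E with hY
  set X2 : ℝ → ℝ := fun r => ∑ k ∈ Finset.range (NH + 1), M.ip (pert ρ D k r) (pert ρ D k r)
    with hX2
  have hX20 : ∀ r, 0 ≤ X2 r := fun r => Finset.sum_nonneg fun k _ => M.ip_self_nonneg _
  have hYX : ∀ r, Y r = 1 / 2 * X2 r + ρ / (2 * T₀) * M.ip (E r) (E r) := fun r => rfl
  have hEE : ∀ r, 0 ≤ ρ / (2 * T₀) * M.ip (E r) (E r) := fun r =>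
    mul_nonneg (by positivity) (M.ip_self_nonneg _)
  have hprim' : ∀ r ∈ I, M.nrm (w r) ≤ K * M.nrm (pert ρ D 0 r) ∧
      ∀ v ∈ U N m, |aStar M T₀ s v (w r)| ≤ K * (M.nrm v * M.nrm (pert ρ D 0 r)) :=
    fun r hr => hprim _ _ (hSV _) (hS _ (h.poisson r hr).neutral)
  have hcross : ∀ r ∈ I, |α * M.ip (D 1 r) (w r)| ≤ 1 / 100 * Y r := by
    intro r hr
    have h1 := M.abs_ip_le (D 1 r) (w r)
    have h2 := (hprim' r hr).1
    have hn0 := M.nrm_nonneg (pert ρ D 0 r)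
    have hn1 := M.nrm_nonneg (D 1 r)
    have h3 : M.nrm (pert ρ D 0 r) ^ 2 + M.nrm (D 1 r) ^ 2 ≤ X2 r := by
      have hsub : ({0, 1} : Finset ℕ) ⊆ Finset.range (NH + 1) := by
        intro k hk
        simp only [Finset.mem_insert, Finset.mem_singleton] at hk
        rw [Finset.mem_range]
        omega
      have h4 := Finset.sum_le_sum_of_subset_of_nonneg hsub
        fun k _ _ => M.ip_self_nonneg (pert ρ D k r)
      rw [Finset.sum_pair (by norm_num)] at h4
      rw [M.nrm_sq, M.nrm_sq]
      exact h4
    rw [abs_mul, abs_of_pos hα0]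
    calc α * |M.ip (D 1 r) (w r)|
        ≤ α * (M.nrm (D 1 r) * (K * M.nrm (pert ρ D 0 r))) := by
          gcongr
          exact h1.trans (by gcongr)
      _ = α * K * (M.nrm (D 1 r) * M.nrm (pert ρ D 0 r)) := by ring
      _ ≤ 1 / 100 * (M.nrm (D 1 r) * M.nrm (pert ρ D 0 r)) := by gcongr
      _ ≤ 1 / 100 * (1 / 2 * X2 r) := by
          refine mul_le_mul_of_nonneg_left ?_ (by norm_num)
          nlinarith [sq_nonneg (M.nrm (D 1 r) - M.nrm (pert ρ D 0 r))]
      _ ≤ 1 / 100 * Y r := by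
          gcongr
          linarith [hYX r, hEE r]
  have hδ : 0 < (μ / (200 * K ^ 2)) ^ 2 := by positivity
  refine exponential_decay hI h0 hI0 (F := fun r => Y r + α * M.ip (D 1 r) (w r)) hα0 hδ
    (fun r _ => by linarith [hYX r, hEE r, hX20 r]) (fun r hr => ?_) (fun r hr => ?_)
    (fun r hr => ?_) hsmall ht
  · have := (abs_le.1 (hcross r hr)).1
    linarith
  · have := (abs_le.1 (hcross r hr)).2
    linarith
  obtain ⟨z, hz0, hz1, hcor⟩ := h.correction_balance hL hT₀ hNH hSV hS hr
  refine ⟨_, (h.energy_balance hL hNH hr).add (hcor.const_mul α), fun hYδ => ?_⟩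
  set Q2 := ∑ k ∈ Finset.range (NH + 1), (k : ℝ) * M.ip (pert ρ D k r) (pert ρ D k r) with hQ2
  have hQ20 : 0 ≤ Q2 :=
    Finset.sum_nonneg fun k _ => mul_nonneg k.cast_nonneg (M.ip_self_nonneg _)
  set n₀ := M.nrm (pert ρ D 0 r) with hn₀
  have hn₀0 : 0 ≤ n₀ := M.nrm_nonneg _
  set x := Real.sqrt (X2 r) with hx
  set q := Real.sqrt Q2 with hq
  have hx0 : 0 ≤ x := Real.sqrt_nonneg _
  have hq0 : 0 ≤ q := Real.sqrt_nonneg _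
  have hq2 : q ^ 2 = Q2 := Real.sq_sqrt hQ20
  have hx2 : x ^ 2 = X2 r := Real.sq_sqrt (hX20 r)
  -- Every mode `k ≥ 1` is damped with weight at least one; only the density needs the correction.
  have hxn : x ^ 2 ≤ n₀ ^ 2 + q ^ 2 := by
    rw [hx2, hq2, hn₀, M.nrm_sq]
    simp only [hX2, hQ2]
    rw [Finset.sum_range_succ', Finset.sum_range_succ' (n := NH)]
    simp only [Nat.cast_zero, zero_mul, add_zero]
    rw [add_comm]
    gcongr with k hk
    have h1 : (1 : ℝ) ≤ ((k + 1 : ℕ) : ℝ) := by exact_mod_cast Nat.succ_le_succ (Nat.zero_le k)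
    exact le_mul_of_one_le_left (M.ip_self_nonneg _) h1
  have hn₀x : n₀ ≤ x := by
    refine Real.sqrt_le_sqrt ?_
    exact Finset.single_le_sum (f := fun k => M.ip (pert ρ D k r) (pert ρ D k r))
      (fun k _ => M.ip_self_nonneg _) (Finset.mem_range.2 (Nat.succ_pos NH))
  -- The range includes `NH + 1` because `D 2` is the closure mode when `NH = 1`.
  have hmode : ∀ k, 1 ≤ k → k ≤ NH + 1 → M.nrm (pert ρ D k r) ≤ q := by
    intro k hk1 hk2
    refine Real.sqrt_le_sqrt ?_
    rcases hk2.eq_or_lt with rfl | hk3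
    · have hz : pert ρ D (NH + 1) r = 0 := h.closure r hr
      rw [hz, ← M.ipForm_apply, map_zero]
      exact hQ20
    · have h1 := Finset.single_le_sum
        (f := fun k : ℕ => (k : ℝ) * M.ip (pert ρ D k r) (pert ρ D k r))
        (fun k _ => mul_nonneg k.cast_nonneg (M.ip_self_nonneg _)) (Finset.mem_range.2 hk3)
      refine le_trans ?_ h1
      exact le_mul_of_one_le_left (M.ip_self_nonneg _) (by exact_mod_cast hk1)
  have hn₁ : M.nrm (D 1 r) ≤ q := hmode 1 le_rfl (by omega)
  have hn₂ : M.nrm (D 2 r) ≤ q := hmode 2 (by norm_num) (by omega)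
  have hxsmall : x ≤ μ / (40 * K ^ 2) := by
    have h1 : x ^ 2 ≤ (μ / (100 * K ^ 2)) ^ 2 := by
      have h2 : (μ / (100 * K ^ 2)) ^ 2 = 4 * (μ / (200 * K ^ 2)) ^ 2 := by
        field_simp; norm_num
      rw [hx2, h2]
      linarith [hYX r, hEE r]
    refine (pow_le_pow_iff_left₀ hx0 (by positivity) two_ne_zero).1 h1 |>.trans ?_
    gcongr
    norm_num
  have hfr : ∀ f u : PW N, Real.sqrt (1 / T₀) * |M.ip (E r * f) u|
      ≤ K * n₀ * M.nrm f * M.nrm u := fun f u => hforce _ _ _ f u (h.poisson r hr)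
  have b1 := sum_force_le (NH := NH) (fun k => pert ρ D k r) (E r) (by positivity) hfr
  change _ ≤ K * n₀ * x * q at b1
  have b2 : Real.sqrt 2 * aStar M T₀ s (D 2 r) (w r) ≤ 2 * K * q * n₀ := by
    have hD2 : D 2 r ∈ U N m := h.pert_mem (k := 2) hr (by omega)
    have h1 := (hprim' r hr).2 _ hD2
    have h2 : Real.sqrt 2 ≤ 2 := by
      rw [Real.sqrt_le_left (by norm_num)]; norm_num
    calc Real.sqrt 2 * aStar M T₀ s (D 2 r) (w r)
        ≤ Real.sqrt 2 * |aStar M T₀ s (D 2 r) (w r)| := by gcongr; exact le_abs_self _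
      _ ≤ 2 * (K * (q * n₀)) := by
          gcongr
          exact h1.trans (by gcongr)
      _ = _ := by ring
  have b3 : Real.sqrt (1 / T₀) * M.ip (E r * pert ρ D 0 r) (w r) ≤ K ^ 2 * n₀ ^ 2 * x := by
    calc Real.sqrt (1 / T₀) * M.ip (E r * pert ρ D 0 r) (w r)
        ≤ Real.sqrt (1 / T₀) * |M.ip (E r * pert ρ D 0 r) (w r)| := by
          gcongr; exact le_abs_self _
      _ ≤ K * n₀ * n₀ * M.nrm (w r) := hfr _ _
      _ ≤ K * n₀ * n₀ * (K * x) := by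
          gcongr
          exact (hprim' r hr).1.trans (by gcongr)
      _ = _ := by ring
  have b4 : -(1 / τ₀ * M.ip (D 1 r) (w r)) ≤ τ₀⁻¹ * K * q * n₀ := by
    have h1 : -M.ip (D 1 r) (w r) ≤ q * (K * n₀) :=
      (neg_le_abs _).trans ((M.abs_ip_le _ _).trans
        (mul_le_mul hn₁ (hprim' r hr).1 (M.nrm_nonneg _) hq0))
    calc -(1 / τ₀ * M.ip (D 1 r) (w r)) = τ₀⁻¹ * -M.ip (D 1 r) (w r) := by
          rw [one_div]; ring
      _ ≤ τ₀⁻¹ * (q * (K * n₀)) := by gcongr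
      _ = _ := by ring
  have b5 : z ≤ q ^ 2 := hz1.trans (by
    rw [← M.nrm_sq]; exact pow_le_pow_left₀ (M.nrm_nonneg _) hn₁ 2)
  have hmain := dissipation_absorbs hK hτ₀ hn₀0 hq0 hxsmall
  rw [← hμ, ← hα] at hmain
  have hn₀sq : M.ip (pert ρ D 0 r) (pert ρ D 0 r) = n₀ ^ 2 := (M.nrm_sq _).symm
  have hα1 : α * (Real.sqrt 2 * aStar M T₀ s (D 2 r) (w r)
      + Real.sqrt (1 / T₀) * M.ip (E r * pert ρ D 0 r) (w r)
      + -(1 / τ₀ * M.ip (D 1 r) (w r)) + z)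
      ≤ α * (2 * K * q * n₀ + K ^ 2 * n₀ ^ 2 * x + τ₀⁻¹ * K * q * n₀ + q ^ 2) := by
    gcongr
  have hα2 : α / 2 * x ^ 2 ≤ α / 2 * (n₀ ^ 2 + q ^ 2) := by gcongr
  have hYr := hYX r
  rw [← hx2] at hYr
  -- The correction dissipates twice the field energy that `α Y` requires; the surplus is discarded.
  have hαE : 0 ≤ α * (ρ / (2 * T₀) * M.ip (E r) (E r)) := mul_nonneg hα0.le (hEE r)
  have hE2 : ρ / T₀ * M.ip (E r) (E r) = 2 * (ρ / (2 * T₀) * M.ip (E r) (E r)) := by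
    field_simp
  rw [hn₀sq, hE2, ← hq2, hYr, one_div τ₀]
  rw [one_div τ₀] at hα1
  change _ - τ₀⁻¹ * q ^ 2 + α * (-n₀ ^ 2 - 2 * (ρ / (2 * T₀) * M.ip (E r) (E r))
    + Real.sqrt 2 * aStar M T₀ s (D 2 r) (w r)
    + Real.sqrt (1 / T₀) * M.ip (E r * pert ρ D 0 r) (w r)
    - τ₀⁻¹ * M.ip (D 1 r) (w r) + z) ≤ _
  linarith

end Main

end VPFP

end

theorem theorem4p1 (T₀ L Cqu : ℝ) (hT₀ : 0 < T₀) (hL : 0 < L) (hCqu : 0 < Cqu) (m : ℕ) :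
    ∃ κ : ℝ, 0 < κ ∧
      ∀ (τ₀ ρ : ℝ), 0 < τ₀ → 0 < ρ →
      ∀ (N : ℕ) [NeZero N] (M : VPFP.Mesh N L), M.QuasiUniform Cqu →
      ∀ (NH : ℕ), 1 ≤ NH →
      ∀ (s : VPFP.Side) (P : VPFP.Poisson)
        (I : Set ℝ), I.OrdConnected → 0 ∈ I → I ⊆ Set.Ici 0 →
      ∀ (D : ℕ → ℝ → VPFP.PW N) (Φ E : ℝ → VPFP.PW N),
        VPFP.IsSolution M m NH s P T₀ τ₀ ρ I D Φ E →
        VPFP.energy M T₀ ρ NH D E 0 ≤ κ ^ 2 * min (τ₀ ^ 2) (τ₀⁻¹ ^ 2) / ρ →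
        ∀ t ∈ I, VPFP.energy M T₀ ρ NH D E t
          ≤ 3 * VPFP.energy M T₀ ρ NH D E 0 * Real.exp (-(κ * min τ₀ τ₀⁻¹ * t)) := by
  obtain ⟨K, hK, hconst⟩ := VPFP.exists_uniform_constant hT₀ hL hCqu m
  have hK0 : 0 < K := zero_lt_one.trans_le hK
  -- The same number serves twice: the rate is `α / 2 = μ / (200 K²)`, and the threshold for `ρ`
  -- times the energy is `(μ / (200 K²))²`, where `μ = min τ₀ τ₀⁻¹`.
  refine ⟨1 / (200 * K ^ 2), by positivity, ?_⟩
  intro τ₀ ρ hτ₀ hρ N _ M hqu NH hNH s P I hI h0 hI0 D Φ E hsol hsmall t ht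
  obtain ⟨hforce, hprim⟩ := hconst M hqu
  have hE : ∀ r, ρ * VPFP.energy M T₀ ρ NH D E r = VPFP.scaledEnergy M T₀ ρ NH D E r :=
    fun r => VPFP.energy_eq M hT₀ hρ NH D E r
  have hμ : min (τ₀ ^ 2) (τ₀⁻¹ ^ 2) = min τ₀ τ₀⁻¹ ^ 2 := by
    have hi := inv_pos.2 hτ₀
    rcases le_total τ₀ τ₀⁻¹ with h1 | h1
    · rw [min_eq_left h1, min_eq_left (pow_le_pow_left₀ hτ₀.le h1 2)]
    · rw [min_eq_right h1, min_eq_right (pow_le_pow_left₀ hi.le h1 2)]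
  have hsmall' : VPFP.scaledEnergy M T₀ ρ NH D E 0 ≤ (min τ₀ τ₀⁻¹ / (200 * K ^ 2)) ^ 2 := by
    rw [hμ, le_div_iff₀ hρ, mul_comm, hE] at hsmall
    refine hsmall.trans_eq ?_
    ring
  have hdecay := hsol.scaledEnergy_le hL hT₀ hτ₀ hρ hK hNH (fun D₀ => hforce P ρ D₀) (hprim s)
    hI h0 hI0 hsmall' ht
  rw [← hE, ← hE] at hdecay
  refine le_of_mul_le_mul_left (hdecay.trans_eq ?_) hρ
  have : min τ₀ τ₀⁻¹ / (100 * K ^ 2) / 2 * t = 1 / (200 * K ^ 2) * min τ₀ τ₀⁻¹ * t := by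
    field_simp
    ring
  rw [this]
  ring
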